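/- **Notation.** For distinct points $\alpha=(\alpha_1,\dots,\alpha_n)$ of a finite field $\mathbb F_q$, let $\mathrm{RS}_{n,k}(\alpha)=\{(f(\alpha_1),\dots,f(\alpha_n)) : f\in\mathbb F_q[x],\ \deg f<k\}$. The $t$-permutation-insdel adversary permutes the coordinates of a codeword arbitrarily and then performs up to $t$ single-symbol insertions and deletions; a code is *robust* against it if the adversary can never produce the same output from two distinct codewords. A *fully anonymous $(t,r,n)$ ramp scheme* ($t<r\le n$) with secrets in $\mathbb F_q$ and shares in a finite set $\Omega$ is a randomized map $\mathrm{Share}:\mathbb F_q\to\Omega^n$ such that (i) for every secret $s$, every $m\le t$, every sequence $I$ of $m$ distinct elements of $[n]$ and every $v\in\Omega^m$, $\Pr[\mathrm{Share}(s)_I=v]=|\Omega|^{-m}$; and (ii) there is a function $\mathrm{Recon}:\Omega^r\to\mathbb F_q$ such that $\mathrm{Recon}(\mathrm{sh}_I)=s$ for every $s$, every possible output $\mathrm{sh}$ of $\mathrm{Share}(s)$ and every sequence $I$ of $r$ distinct elements of $[n]$. The *Shamir scheme* with points $\alpha$ draws a uniformly random $f\in\mathbb F_q[x]$ with $\deg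 f<k$ and $f(0)=s$ and gives participant $i$ the share $f(\alpha_i)$ only. For $k,e,n\ge 1$, a *power construction with exponent $e$* consists of a prime $p>k^2e$ with $p\ge n$, an extension $\mathbb F_q=\mathbb F_p(\gamma)$ of $\mathbb F_p$ of degree $k^2e$, and the points $\alpha_i=(\gamma-i)^{e}$, $1\le i\le n$. Put $\ell=((2k)!)^2$. **Theorem.** 1. Let $k\ge1$ and $2k-1\le n$. For every power construction with exponent $\ell$, the field has size $q=p^{k^2\ell}$, the points $\alpha_1,\dots,\alpha_n$ are distinct and nonzero, $\mathrm{RS}_{n,k}(\alpha)$ is robust against the $(n-2k+1)$-permutation-insdel adversary, and the Shamir scheme with points $\alpha$ is a fully anonymous $(k-1,2k-1,n)$ ramp scheme with secrets and shares in $\mathbb F_q$. 2. There is an absolute constant $c$ such that for all integers $A\ge 0$, $k\ge1$ and $n\ge2$ with $2k-1\le n$ and $k^2\ell\le n^{A}$ there is a power construction with exponent $\ell$ over a field of size $q\le n^{cA\,k^2\ell}$. (So for $k^2\ell\le n^{O(1)}$ the field has size $n^{O(k^2((2k)!)^2)}$.) 3. There is an absolute constant $c$ such that for all $k\ge1$ and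 $n\ge2$ with $2k-1\le n$ there are an exponent $e\le\ell$ and a power construction with exponent $e$ over a field of size $q\le n^{c\,k^2((2k)!)^2}$ whose points are distinct and nonzero, whose code $\mathrm{RS}_{n,k}(\alpha)$ is robust against the $(n-2k+1)$-permutation-insdel adversary, and whose Shamir scheme is a fully anonymous $(k-1,2k-1,n)$ ramp scheme with secrets and shares in $\mathbb F_q$. -/

import Mathlib

open Polynomial
open scoped ENNReal Nat IntermediateField

/-- The Reed–Solomon code of dimension `k` with evaluation points `α`. -/
def rsCode {F : Type*} [Field F] {n : ℕ} (k : ℕ) (α : Fin n → F) : Set (Fin n → F) :=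
  {c | ∃ f : F[X], f.degree < (k : WithBot ℕ) ∧ c = fun i => f.eval (α i)}

/-- A single insertion or deletion of one symbol, at an arbitrary place of a string. -/
inductive InsdelStep {A : Type*} : List A → List A → Prop
  | deletion (u v : List A) (a : A) : InsdelStep (u ++ a :: v) (u ++ v)
  | insertion (u v : List A) (a : A) : InsdelStep (u ++ v) (u ++ a :: v)

/-- `InsdelErrors m s w`: the string `w` arises from `s` by exactly `m` successive insdel errors. -/
def InsdelErrors {A : Type*} : ℕ → List A → List A → Prop
  | 0, s, w => s = w
  | m + 1, s, w => ∃ u, InsdelStep s u ∧ InsdelErrors m u w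

/-- The possible outputs of the `t`-permutation-insdel adversary on `c`: it permutes the symbols
of `c` arbitrarily and then performs up to `t` insdel errors. -/
def adversaryOutputs {A : Type*} {n : ℕ} (t : ℕ) (c : Fin n → A) : Set (List A) :=
  {w | ∃ π : Equiv.Perm (Fin n), ∃ m ≤ t, InsdelErrors m (List.ofFn fun i => c (π i)) w}

/-- Robustness against the `t`-permutation-insdel adversary: it cannot produce the same output on
two distinct codewords. -/
def RobustPermInsdel {A : Type*} {n : ℕ} (t : ℕ) (C : Set (Fin n → A)) : Prop :=
  ∀ c ∈ C, ∀ c' ∈ C, c ≠ c' → Disjoint (adversaryOutputs t c) (adversaryOutputs t c')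

/-- `Share`, a randomized map from secrets in `S` to vectors of `n` shares in the common finite
share domain `Ω`, is a fully anonymous `(t, r, n)` ramp secret-sharing scheme. -/
structure IsFullyAnonymousRamp {S Ω : Type*} [Fintype Ω] (t r n : ℕ)
    (Share : S → PMF (Fin n → Ω)) : Prop where
  gap : t < r
  threshold_le : r ≤ n
  share_anonymity : ∀ (s : S) (m : ℕ), m ≤ t → ∀ I : Fin m → Fin n, Function.Injective I →
    ∀ v : Fin m → Ω,
      (Share s).toOuterMeasure {sh | (fun j => sh (I j)) = v} = ((Fintype.card Ω : ℝ≥0∞)⁻¹) ^ m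
  anonymous_recon : ∃ Recon : (Fin r → Ω) → S, ∀ (s : S) (I : Fin r → Fin n),
    Function.Injective I → ∀ sh ∈ (Share s).support, Recon (fun j => sh (I j)) = s

/-- Identity-free Shamir sharing: for a secret `s`, draw a uniformly random polynomial `f` with
`deg f < k` and `f(0) = s` (that is, draw its `k - 1` non-constant coefficients uniformly), and
give participant `i` the share `f (α i)`. -/
noncomputable def shamirShare {F : Type*} [Field F] [Fintype F] {n : ℕ} (k : ℕ) (α : Fin n → F)
    (s : F) : PMF (Fin n → F) :=
  (PMF.uniformOfFintype (Fin (k - 1) → F)).map fun a i =>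
    (C s + ∑ j : Fin (k - 1), C (a j) * X ^ ((j : ℕ) + 1)).eval (α i)

/-- The exponent `ℓ = ((2k)!)²`. -/
def ell (k : ℕ) : ℕ := ((2 * k)!) ^ 2

/-- The evaluation points `(γ - i) ^ e`, for `1 ≤ i ≤ n`. -/
def powPoints {F : Type*} [Field F] (γ : F) (e n : ℕ) : Fin n → F :=
  fun i => (γ - (((i : ℕ) + 1 : ℕ) : F)) ^ e

/-- The parameters of the power construction with exponent `e`: a prime `p > k² e` with `n ≤ p`,
and an extension `F = 𝔽_p(γ)` of degree `k² e`. -/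
structure IsPowConstruction (k e n p : ℕ) [Fact p.Prime] (F : Type*) [Field F]
    [Algebra (ZMod p) F] (γ : F) : Prop where
  lt_prime : k ^ 2 * e < p
  le_prime : n ≤ p
  finrank_eq : Module.finrank (ZMod p) F = k ^ 2 * e
  adjoin_eq : (ZMod p)⟮γ⟯ = ⊤

/-! ### Wronskians for the Euler operator and a Mason–Stothers type bound. -/

section Wronskian

theorem Polynomial.coeff_prod_sum_of_natDegree_le {R ι : Type*} [CommSemiring R] (s : Finset ι)
    (f : ι → R[X]) (d : ι → ℕ) (h : ∀ i ∈ s, (f i).natDegree ≤ d i) :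
    (∏ i ∈ s, f i).coeff (∑ i ∈ s, d i) = ∏ i ∈ s, (f i).coeff (d i) := by
  classical
  induction s using Finset.induction_on with
  | empty => simp
  | insert a s ha ih =>
    have h1 : ∀ i ∈ s, (f i).natDegree ≤ d i := fun i hi => h i (Finset.mem_insert_of_mem hi)
    rw [Finset.prod_insert ha, Finset.sum_insert ha, Finset.prod_insert ha, ← ih h1]
    exact coeff_mul_add_eq_of_natDegree_le (h a (Finset.mem_insert_self a s))
      ((natDegree_prod_le s f).trans (Finset.sum_le_sum h1))

/-- Used twice to show that a determinant is nonzero: for the Wronskian, and for sending one point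
of a matching to infinity. -/
theorem Matrix.coeff_det_of_natDegree_le {R ι : Type*} [CommRing R] [Fintype ι] [DecidableEq ι]
    (M : Matrix ι ι R[X]) (d : ι → ℕ) (h : ∀ i j, (M i j).natDegree ≤ d i) :
    M.det.coeff (∑ i, d i) = (Matrix.of fun i j => (M i j).coeff (d i)).det := by
  rw [Matrix.det_apply, Matrix.det_apply, finsetSum_coeff]
  refine Finset.sum_congr rfl fun σ _ => ?_
  have h1 := Polynomial.coeff_prod_sum_of_natDegree_le Finset.univ (fun i => M (σ i) i)
    (fun i => d (σ i)) fun i _ => h (σ i) i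
  rw [Equiv.sum_comp σ d] at h1
  rcases Int.units_eq_one_or (Equiv.Perm.sign σ) with hs | hs <;> simp [hs, h1]

theorem Matrix.natDegree_det_le_sum {R ι : Type*} [CommRing R] [Fintype ι] [DecidableEq ι]
    (M : Matrix ι ι R[X]) (d : ι → ℕ) (h : ∀ i j, (M i j).natDegree ≤ d i) :
    M.det.natDegree ≤ ∑ i, d i := by
  rw [Matrix.det_apply]
  refine natDegree_sum_le_of_forall_le _ _ fun σ _ => ?_
  refine (natDegree_smul_le _ _).trans ((natDegree_prod_le _ _).trans ?_)
  rw [← Equiv.sum_comp σ d]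
  exact Finset.sum_le_sum fun i _ => h (σ i) i

/-- The Euler operator `X · d/dX`. -/
noncomputable def eulerOp (K : Type*) [Field K] : K[X] →ₗ[K] K[X] :=
  (LinearMap.mulLeft K X) ∘ₗ derivative

variable {K : Type*} [Field K]

theorem eulerOp_apply (f : K[X]) : eulerOp K f = X * derivative f := rfl

theorem coeff_eulerOp (f : K[X]) (m : ℕ) : (eulerOp K f).coeff m = m * f.coeff m := by
  rw [eulerOp_apply]
  cases m with
  | zero => simp
  | succ m => rw [coeff_X_mul, coeff_derivative]; push_cast; ring

theorem coeff_eulerOp_pow (i : ℕ) (f : K[X]) (m : ℕ) :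
    ((eulerOp K ^ i) f).coeff m = (m : K) ^ i * f.coeff m := by
  induction i with
  | zero => simp
  | succ i ih => rw [pow_succ', Module.End.mul_apply, coeff_eulerOp, ih]; ring

theorem natDegree_eulerOp_pow_le (i : ℕ) (f : K[X]) :
    ((eulerOp K ^ i) f).natDegree ≤ f.natDegree := by
  rw [natDegree_le_iff_coeff_eq_zero]
  intro m hm
  rw [coeff_eulerOp_pow, coeff_eq_zero_of_natDegree_lt hm, mul_zero]

theorem pow_sub_dvd_eulerOp_pow (P f : K[X]) (e i : ℕ) (h : P ^ e ∣ f) :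
    P ^ (e - i) ∣ (eulerOp K ^ i) f := by
  induction i with
  | zero => simpa using h
  | succ i ih =>
    rw [pow_succ', Module.End.mul_apply, eulerOp_apply]
    refine Dvd.dvd.mul_left ?_ _
    rw [← Nat.sub_sub]
    exact pow_sub_one_dvd_derivative_of_pow_dvd ih

/-- The Wronskian matrix of a family of polynomials with respect to the Euler operator. -/
noncomputable def eulerMatrix {d : ℕ} (Q : Fin d → K[X]) : Matrix (Fin d) (Fin d) K[X] :=
  Matrix.of fun j i => (eulerOp K ^ (i : ℕ)) (Q j)

theorem eulerMatrix_update {d : ℕ} (Q : Fin d → K[X]) (j : Fin d) (q : K[X]) :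
    eulerMatrix (Function.update Q j q)
      = (eulerMatrix Q).updateRow j fun i => (eulerOp K ^ (i : ℕ)) q := by
  ext1 l i
  by_cases h : l = j
  · subst h; simp [eulerMatrix]
  · simp [eulerMatrix, h]

/-- Serves both to lower degrees by row reduction and to bring `P₀ ^ e` into the Wronskian of the
other powers. -/
theorem det_eulerMatrix_update_sum {d : ℕ} (Q : Fin d → K[X]) (j : Fin d) (b : Fin d → K) :
    (eulerMatrix (Function.update Q j (∑ l, b l • Q l))).det = C (b j) * (eulerMatrix Q).det := by
  rw [eulerMatrix_update]
  have := Matrix.det_updateRow_sum (eulerMatrix Q) j fun l => C (b l)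
  rw [smul_eq_mul] at this
  rw [← this]
  congr 2
  ext1 i
  simp only [eulerMatrix, map_sum, map_smul, Finset.sum_apply, Pi.smul_apply, Matrix.of_apply,
    smul_eq_mul]
  simp only [smul_eq_C_mul]

theorem LinearIndependent.update_sum {ι V : Type*} [Fintype ι] [DecidableEq ι] [AddCommGroup V]
    [Module K V] {Q : ι → V} (hQ : LinearIndependent K Q) (j : ι) (b : ι → K) (hb : b j ≠ 0) :
    LinearIndependent K (Function.update Q j (∑ l, b l • Q l)) := by
  rw [Fintype.linearIndependent_iff] at hQ ⊢
  intro g hg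
  have h1 : ∑ i, (Function.update g j 0 i + g j * b i) • Q i = 0 := by
    rw [← hg, ← Finset.add_sum_erase _ _ (Finset.mem_univ j),
      ← Finset.add_sum_erase (a := j) (f := fun i => g i • _) _ (Finset.mem_univ j)]
    have h2 : ∀ i ∈ Finset.univ.erase j, g i • Function.update Q j (∑ l, b l • Q l) i
        = g i • Q i := fun i hi => by rw [Function.update_of_ne (Finset.ne_of_mem_erase hi)]
    have h3 : ∀ i ∈ Finset.univ.erase j, (Function.update g j 0 i + g j * b i) • Q i
        = g i • Q i + g j • b i • Q i := fun i hi => by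
      rw [Function.update_of_ne (Finset.ne_of_mem_erase hi), add_smul, mul_smul]
    rw [Finset.sum_congr rfl h2, Finset.sum_congr rfl h3, Finset.sum_add_distrib,
      ← Finset.smul_sum, Function.update_self, Function.update_self,
      ← Finset.add_sum_erase (a := j) (f := fun l => b l • Q l) _ (Finset.mem_univ j),
      smul_add, zero_add, mul_smul]
    abel
  have h4 := hQ _ h1
  have h5 : g j = 0 := by
    have := h4 j
    rw [Function.update_self, zero_add] at this
    exact (mul_eq_zero.mp this).resolve_right hb
  intro i
  by_cases h : i = j
  · rw [h, h5]
  · simpa [h, h5] using h4 i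

/-- Linearly independent polynomials of degree less than the characteristic have a nonzero
Wronskian. -/
theorem det_eulerMatrix_ne_zero (p : ℕ) [CharP K p] {d : ℕ} (Q : Fin d → K[X])
    (hQ : LinearIndependent K Q) (hp : ∀ j, (Q j).natDegree < p) :
    (eulerMatrix Q).det ≠ 0 := by
  induction h : ∑ j, (Q j).natDegree using Nat.strong_induction_on generalizing Q with
  | _ N ih =>
  -- The Euler operator is diagonal on monomials. For distinct degrees the top coefficient is
  -- therefore the product of the leading coefficients and a Vandermonde determinant in the degrees,
  -- which remain distinct modulo `p`.
  by_cases hinj : Function.Injective fun j => (Q j).natDegree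
  · intro h0
    have h1 := Matrix.coeff_det_of_natDegree_le (eulerMatrix Q) (fun j => (Q j).natDegree)
      fun j i => natDegree_eulerOp_pow_le _ _
    rw [h0, coeff_zero] at h1
    have h2 : (Matrix.of fun i j => (eulerMatrix Q i j).coeff (Q i).natDegree)
        = Matrix.of fun i j => (Q i).leadingCoeff
          * Matrix.vandermonde (fun i => ((Q i).natDegree : K)) i j := by
      ext i j
      simp [eulerMatrix, coeff_eulerOp_pow, Matrix.vandermonde_apply, mul_comm]
    rw [h2, Matrix.det_mul_column] at h1
    refine mul_ne_zero ?_ ?_ h1.symm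
    · exact Finset.prod_ne_zero_iff.mpr fun j _ => leadingCoeff_ne_zero.mpr (hQ.ne_zero j)
    · rw [Matrix.det_vandermonde_ne_zero_iff]
      intro i j hij
      exact hinj (CharP.natCast_injOn_Iio K p (hp i) (hp j) hij)
  · simp only [Function.Injective, not_forall] at hinj
    obtain ⟨i, j, hij, hne⟩ := hinj
    -- For two equal degrees, cancelling a leading term lowers the total degree and keeps the
    -- Wronskian.
    set c : K := (Q j).leadingCoeff / (Q i).leadingCoeff with hc
    have hi0 : (Q i).leadingCoeff ≠ 0 := leadingCoeff_ne_zero.mpr (hQ.ne_zero i)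
    set b : Fin d → K := fun l => if l = j then 1 else if l = i then -c else 0 with hb
    have hsum : ∑ l, b l • Q l = Q j - c • Q i := by
      rw [← Finset.add_sum_erase _ _ (Finset.mem_univ j),
        ← Finset.add_sum_erase (a := i) _ _ (by simp [hne])]
      rw [Finset.sum_eq_zero]
      · simp [hb, hne, sub_eq_add_neg]
      · intro l hl
        simp only [Finset.mem_erase] at hl
        simp [hb, hl.1, hl.2.1]
    have hbj : b j = 1 := by simp [hb]
    have hQ' := hQ.update_sum j b (by simp [hbj])
    have hne0 : Q j - c • Q i ≠ 0 := by
      have := hQ'.ne_zero j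
      rwa [Function.update_self, hsum] at this
    have hlt : (Q j - c • Q i).natDegree < (Q j).natDegree := by
      apply natDegree_lt_natDegree hne0
      have hci : c ≠ 0 := div_ne_zero (leadingCoeff_ne_zero.mpr (hQ.ne_zero j)) hi0
      refine degree_sub_lt_left ?_ (hQ.ne_zero j) ?_
      · rw [smul_eq_C_mul, degree_C_mul hci, degree_eq_natDegree (hQ.ne_zero j),
          degree_eq_natDegree (hQ.ne_zero i)]
        exact congrArg _ hij.symm
      · rw [smul_eq_C_mul, leadingCoeff_mul, leadingCoeff_C, hc, div_mul_cancel₀ _ hi0]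
    have hdeg : ∀ l, (Function.update Q j (∑ l, b l • Q l) l).natDegree ≤ (Q l).natDegree := by
      intro l
      by_cases hl : l = j
      · subst hl; rw [Function.update_self, hsum]; exact hlt.le
      · rw [Function.update_of_ne hl]
    have := ih _ ?_ (Function.update Q j (∑ l, b l • Q l)) hQ' (fun l => (hdeg l).trans_lt (hp l)) rfl
    · rw [det_eulerMatrix_update_sum, hbj, C_1, one_mul] at this
      exact this
    · rw [← h]
      refine Finset.sum_lt_sum (fun l _ => hdeg l) ⟨j, Finset.mem_univ j, ?_⟩
      rw [Function.update_self, hsum]; exact hlt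

/-- Each of the at most `d - 1` derivatives costs one factor of `P j`, so a power can be pulled out
of every row. -/
theorem prod_pow_dvd_det_eulerMatrix {d : ℕ} (P Q : Fin d → K[X]) (e : ℕ)
    (h : ∀ j, P j ^ e ∣ Q j) : ∏ j, P j ^ (e - (d - 1)) ∣ (eulerMatrix Q).det := by
  have h1 : ∀ j i, P j ^ (e - (d - 1)) ∣ eulerMatrix Q j i := fun j i =>
    (pow_dvd_pow _ (by have := i.2; omega)).trans (pow_sub_dvd_eulerOp_pow _ _ e i (h j))
  choose B hB using h1
  have : eulerMatrix Q = Matrix.of fun j i => P j ^ (e - (d - 1)) * Matrix.of B j i := by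
    ext1 j i; simp [hB]
  rw [this, Matrix.det_mul_column]
  exact dvd_mul_right _ _

/-- A Mason–Stothers type bound for sums of `e`-th powers without common factor. -/
theorem natDegree_bound_of_pow_eq_sum (p : ℕ) [CharP K p] {d e : ℕ} (P : Fin d → K[X])
    (P₀ : K[X]) (b : Fin d → K) (hb : ∀ j, b j ≠ 0)
    (hind : LinearIndependent K fun j => P j ^ e) (hsum : P₀ ^ e = ∑ j, b j • P j ^ e)
    (hdeg : ∀ j, (P j).natDegree ≤ P₀.natDegree) (hp : e * P₀.natDegree < p)
    (hP₀ : P₀ ≠ 0) (hP : ∀ j, P j ≠ 0)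
    (htop : Ideal.span (insert P₀ (Set.range P)) = ⊤) (hde : d - 1 ≤ e) :
    e * P₀.natDegree ≤ (d - 1) * (d + 1) * P₀.natDegree := by
  set Q : Fin d → K[X] := fun j => P j ^ e with hQ
  set W := (eulerMatrix Q).det with hW
  set e' := e - (d - 1) with he'
  have hW0 : W ≠ 0 := by
    refine det_eulerMatrix_ne_zero p Q hind fun j => ?_
    rw [hQ]; simp only [natDegree_pow]
    exact (Nat.mul_le_mul_left e (hdeg j)).trans_lt hp
  have hdegW : W.natDegree ≤ ∑ j, e * (P j).natDegree := by
    refine Matrix.natDegree_det_le_sum _ _ fun j i => ?_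
    refine (natDegree_eulerOp_pow_le _ _).trans ?_
    rw [hQ]; simp [natDegree_pow]
  set T := P₀ ^ e' * ∏ j, P j ^ e' with hT
  -- The `r` with `T ∣ r * W` form an ideal. It contains every `y ^ e'`, because `W`, up to a unit,
  -- is also the Wronskian with `P₀ ^ e` replacing any one row. Coprimality then puts `1` in it.
  have hall : ∀ r ∈ Ideal.span ((fun x => x ^ e') '' insert P₀ (Set.range P)), T ∣ r * W := by
    intro r hr
    induction hr using Submodule.span_induction with
    | zero => simp
    | add x y _ _ hx hy => rw [add_mul]; exact dvd_add hx hy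
    | smul a x _ hx => rw [smul_eq_mul, mul_assoc]; exact hx.mul_left _
    | mem x hx =>
      obtain ⟨y, hy, rfl⟩ := hx
      rcases hy with rfl | ⟨j, rfl⟩
      · exact mul_dvd_mul_left _ (prod_pow_dvd_det_eulerMatrix P Q e fun _ => dvd_rfl)
      · have h1 := prod_pow_dvd_det_eulerMatrix (Function.update P j P₀)
          (Function.update Q j (∑ l, b l • Q l)) e fun l => by
            by_cases hl : l = j
            · subst hl; rw [Function.update_self, Function.update_self, ← hsum]
            · rw [Function.update_of_ne hl, Function.update_of_ne hl]
        rw [det_eulerMatrix_update_sum] at h1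
        have h2 : IsUnit (C (b j)) := isUnit_C.mpr (isUnit_iff_ne_zero.mpr (hb j))
        rw [h2.dvd_mul_left] at h1
        have h3 : T = P j ^ e' * ∏ l, Function.update P j P₀ l ^ e' := by
          rw [hT, ← Finset.mul_prod_erase _ _ (Finset.mem_univ j),
            ← Finset.mul_prod_erase (a := j) (f := fun l => Function.update P j P₀ l ^ e') _
              (Finset.mem_univ j), Function.update_self]
          have h4 : ∀ l ∈ Finset.univ.erase j, Function.update P j P₀ l ^ e' = P l ^ e' :=
            fun l hl => by rw [Function.update_of_ne (Finset.ne_of_mem_erase hl)]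
          rw [Finset.prod_congr rfl h4]
          ring
        rw [h3]
        exact mul_dvd_mul_left _ h1
  have hTW : T ∣ W := by
    have := hall 1 (by rw [Ideal.span_pow_eq_top _ htop]; trivial)
    rwa [one_mul] at this
  have hTdeg : T.natDegree = e' * P₀.natDegree + ∑ j, e' * (P j).natDegree := by
    rw [hT, natDegree_mul (pow_ne_zero _ hP₀)
      (Finset.prod_ne_zero_iff.mpr fun j _ => pow_ne_zero _ (hP j)), natDegree_pow,
      natDegree_prod _ _ fun j _ => pow_ne_zero _ (hP j)]
    simp [natDegree_pow]
  -- The degrees of `T` and `W` give `e' * deg P₀ ≤ (d - 1) * ∑ deg P j`.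
  have h4 := (natDegree_le_of_dvd hTW hW0).trans hdegW
  rw [hTdeg, ← Finset.mul_sum, ← Finset.mul_sum] at h4
  have h5 : ∑ j, (P j).natDegree ≤ d * P₀.natDegree := by
    refine (Finset.sum_le_card_nsmul _ _ _ fun j _ => hdeg j).trans ?_
    simp
  obtain ⟨u, hu⟩ : ∃ u, u = d - 1 := ⟨_, rfl⟩
  have h6 : e = e' + u := by omega
  rw [← hu, h6]
  have h7 : u * ∑ j, (P j).natDegree ≤ u * (d * P₀.natDegree) := Nat.mul_le_mul_left _ h5
  rw [h6] at h4
  nlinarith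

end Wronskian

/-! ### Linear independence of high powers. -/

section PowerIndependence

variable {K : Type*} [Field K]

theorem exists_common_factor {ι : Type*} [Finite ι] (P : ι → K[X]) (P₀ : K[X])
    (hP₀ : P₀ ≠ 0) : ∃ (g A₀ : K[X]) (A : ι → K[X]), P₀ = g * A₀ ∧ (∀ j, P j = g * A j) ∧
      Ideal.span (insert A₀ (Set.range A)) = ⊤ := by
  cases nonempty_fintype ι
  set I : Ideal K[X] := Ideal.span (insert P₀ (Set.range P)) with hI
  set g := Submodule.IsPrincipal.generator I with hg
  have hdvd : ∀ x ∈ I, ∃ y, x = g * y := fun x hx => by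
    obtain ⟨s, hs⟩ := (Submodule.IsPrincipal.mem_iff_eq_smul_generator I).mp hx
    exact ⟨s, by rw [hs, smul_eq_mul, mul_comm]⟩
  obtain ⟨A₀, hA₀⟩ := hdvd P₀ (Ideal.subset_span (Set.mem_insert _ _))
  choose A hA using fun j => hdvd (P j) (Ideal.subset_span (Set.mem_insert_of_mem _ ⟨j, rfl⟩))
  refine ⟨g, A₀, A, hA₀, hA, ?_⟩
  have hg0 : g ≠ 0 := fun h => hP₀ (by rw [hA₀, h, zero_mul])
  have hgI : g ∈ I := Submodule.IsPrincipal.generator_mem I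
  rw [hI, Ideal.mem_span_insert] at hgI
  obtain ⟨a, z, hz, hgz⟩ := hgI
  obtain ⟨c, hc⟩ := Ideal.mem_span_range_iff_exists_fun.mp hz
  rw [Ideal.eq_top_iff_one, Ideal.mem_span_insert]
  refine ⟨a, ∑ i, c i * A i, Ideal.mem_span_range_iff_exists_fun.mpr ⟨c, rfl⟩, ?_⟩
  apply mul_left_cancel₀ hg0
  rw [mul_one, mul_add, Finset.mul_sum]
  nth_rewrite 1 [hgz]
  rw [← hc, hA₀]
  congr 1
  · ring
  · exact Finset.sum_congr rfl fun i _ => by rw [hA i]; ring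

/-- After division by the common factor, the degree bound contradicts `(d + 1) ^ 2 ≤ e` unless all
cofactors are constant, and then `P₀` is proportional to some `P j`. -/
theorem pow_ne_sum_smul_pow (p : ℕ) [CharP K p] {d e : ℕ} (P : Fin d → K[X])
    (P₀ : K[X]) (b : Fin d → K) (hb : ∀ j, b j ≠ 0)
    (hind : LinearIndependent K fun j => P j ^ e)
    (hdeg : ∀ j, (P j).natDegree ≤ P₀.natDegree) (hp : e * P₀.natDegree < p)
    (hP₀ : P₀ ≠ 0) (hP : ∀ j, P j ≠ 0) (hprop : ∀ j (c : K), P₀ ≠ C c * P j)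
    (hde : (d + 1) ^ 2 ≤ e) : P₀ ^ e ≠ ∑ j, b j • P j ^ e := by
  intro hsum
  obtain ⟨g, A₀, A, hA₀, hA, htop⟩ := exists_common_factor P P₀ hP₀
  have hg0 : g ≠ 0 := fun h => hP₀ (by rw [hA₀, h, zero_mul])
  have hA₀0 : A₀ ≠ 0 := fun h => hP₀ (by rw [hA₀, h, mul_zero])
  have hA0 : ∀ j, A j ≠ 0 := fun j h => hP j (by rw [hA, h, mul_zero])
  have hdegA : ∀ j, (A j).natDegree ≤ A₀.natDegree := fun j => by
    have := hdeg j
    rw [hA, hA₀, natDegree_mul hg0 (hA0 j), natDegree_mul hg0 hA₀0] at this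
    omega
  have hindA : LinearIndependent K fun j => A j ^ e := by
    refine LinearIndependent.of_comp (LinearMap.mulLeft K (g ^ e)) ?_
    have h1 : (fun j => P j ^ e) = LinearMap.mulLeft K (g ^ e) ∘ fun j => A j ^ e := by
      ext1 j; simp [hA, mul_pow]
    rwa [← h1]
  have hsumA : A₀ ^ e = ∑ j, b j • A j ^ e := by
    apply mul_left_cancel₀ (pow_ne_zero e hg0)
    rw [← mul_pow, ← hA₀, hsum, Finset.mul_sum]
    refine Finset.sum_congr rfl fun j _ => ?_
    rw [hA j, mul_pow, mul_smul_comm]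
  have hpA : e * A₀.natDegree < p := by
    refine (Nat.mul_le_mul_left e ?_).trans_lt hp
    rw [hA₀, natDegree_mul hg0 hA₀0]
    omega
  have key := natDegree_bound_of_pow_eq_sum p A A₀ b hb hindA hsumA hdegA hpA hA₀0 hA0 htop
    (by nlinarith [Nat.sub_le d 1])
  rcases Nat.eq_zero_or_pos A₀.natDegree with h0 | hpos
  · rcases Nat.eq_zero_or_pos d with hd | hd
    · subst hd
      rw [Finset.univ_eq_empty, Finset.sum_empty] at hsum
      exact pow_ne_zero e hP₀ hsum
    · have h1 := eq_C_of_natDegree_eq_zero h0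
      have h2 := eq_C_of_natDegree_eq_zero (Nat.le_zero.mp (h0 ▸ hdegA ⟨0, hd⟩))
      have h3 : (A ⟨0, hd⟩).coeff 0 ≠ 0 := fun h => hA0 ⟨0, hd⟩ (by rw [h2, h, C_0])
      refine hprop ⟨0, hd⟩ (A₀.coeff 0 / (A ⟨0, hd⟩).coeff 0) ?_
      rw [hA₀, hA, mul_left_comm]
      congr 1
      rw [h2, h1, coeff_C_zero, coeff_C_zero, ← C_mul, div_mul_cancel₀ _ h3]
  · have h1 := Nat.le_of_mul_le_mul_right key hpos
    have h2 : (d - 1) * (d + 1) ≤ d * (d + 1) := Nat.mul_le_mul_right _ (Nat.sub_le d 1)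
    nlinarith

/-- Large powers of few pairwise non-proportional polynomials of small degree are linearly
independent. -/
theorem linearIndepOn_pow (p : ℕ) [CharP K p] {ι : Type*} {e : ℕ} (s : Finset ι)
    (P : ι → K[X]) (h0 : ∀ i ∈ s, P i ≠ 0)
    (hprop : ∀ i ∈ s, ∀ j ∈ s, i ≠ j → ∀ c : K, P i ≠ C c * P j)
    (hp : ∀ i ∈ s, e * (P i).natDegree < p) (he : s.card ^ 2 ≤ e) :
    LinearIndepOn K (fun i => P i ^ e) (s : Set ι) := by
  classical
  -- Insertion in order of degree makes the new polynomial dominate the degrees, as `P₀` must.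
  induction s using Finset.induction_on_max_value (fun i => (P i).natDegree) with
  | empty => simp
  | insert a s ha hmax ih =>
    have hind := ih (fun i hi => h0 i (Finset.mem_insert_of_mem hi))
      (fun i hi j hj => hprop i (Finset.mem_insert_of_mem hi) j (Finset.mem_insert_of_mem hj))
      (fun i hi => hp i (Finset.mem_insert_of_mem hi))
      ((Nat.pow_le_pow_left (Finset.card_le_card (Finset.subset_insert a s)) 2).trans he)
    rw [Finset.coe_insert]
    refine hind.insert fun hmem => ?_
    obtain ⟨b, hb⟩ := (Submodule.mem_span_image_finset_iff_exists_fun K).mp hmem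
    -- Only the terms with nonzero coefficient are kept: the Wronskian argument divides by each `b
    -- j`.
    set t : Finset s := Finset.univ.filter fun i => b i ≠ 0 with ht
    set ε := t.equivFin with hε
    have hts : t.card ≤ s.card := (Finset.card_le_univ t).trans (by simp)
    have hsi : ∀ i : s, (i : ι) ∈ insert a s := fun i => Finset.mem_insert_of_mem i.2
    refine pow_ne_sum_smul_pow p (e := e) (fun j => P (ε.symm j).1.1) (P a)
      (fun j => b (ε.symm j).1) ?_ ?_ ?_ (hp a (Finset.mem_insert_self a s))
      (h0 a (Finset.mem_insert_self a s)) ?_ ?_ ?_ ?_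
    · intro j
      exact (Finset.mem_filter.mp (ε.symm j).2).2
    · refine LinearIndependent.comp hind (fun j => (ε.symm j).1) ?_
      exact Subtype.val_injective.comp ε.symm.injective
    · exact fun j => hmax _ (ε.symm j).1.2
    · exact fun j => h0 _ (hsi _)
    · intro j c
      refine hprop a (Finset.mem_insert_self a s) _ (hsi _) ?_ c
      rintro h
      exact ha (h ▸ (ε.symm j).1.2)
    · rw [Finset.card_insert_of_notMem ha] at he
      exact (Nat.pow_le_pow_left (by omega) 2).trans he
    · rw [← hb]
      rw [Equiv.sum_comp ε.symm fun i : t => b i.1 • P i.1.1 ^ e,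
        Finset.sum_coe_sort t fun i => b i • P i ^ e, ht, Finset.sum_filter]
      refine Finset.sum_congr rfl fun i _ => ?_
      split_ifs with h
      · rfl
      · rw [not_not.mp h, zero_smul]

theorem count_roots_prod_X_sub_C_pow [DecidableEq K] {n : ℕ} (a : Fin n → K)
    (ha : Function.Injective a) (m : Fin n → ℕ) (i : Fin n) :
    (∏ j, (X - C (a j)) ^ m j).roots.count (a i) = m i := by
  rw [roots_prod _ _ (Finset.prod_ne_zero_iff.mpr fun j _ => pow_ne_zero _ (X_sub_C_ne_zero _)),
    Multiset.count_bind]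
  simp only [roots_pow, roots_X_sub_C, Multiset.count_nsmul, Multiset.count_singleton]
  change ∑ j, m j * (if a i = a j then 1 else 0) = m i
  simp [ha.eq_iff]

end PowerIndependence

/-! ### From nonzero polynomials to nonvanishing at the points. -/

section Transfer

variable {k e n p : ℕ} [Fact p.Prime] {F : Type*} [Field F] [Algebra (ZMod p) F] {γ : F}

theorem IsPowConstruction.natDegree_minpoly (h : IsPowConstruction k e n p F γ)
    (hpos : 0 < k ^ 2 * e) : (minpoly (ZMod p) γ).natDegree = k ^ 2 * e := by
  have : FiniteDimensional (ZMod p) F :=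
    Module.finite_of_finrank_pos (by rw [h.finrank_eq]; exact hpos)
  rw [← IntermediateField.adjoin.finrank (Algebra.IsIntegral.isIntegral γ), h.adjoin_eq,
    IntermediateField.finrank_top', h.finrank_eq]

theorem IsPowConstruction.aeval_ne_zero (h : IsPowConstruction k e n p F γ)
    {G : (ZMod p)[X]} (hG : G ≠ 0) (hdeg : G.natDegree < k ^ 2 * e) : aeval γ G ≠ 0 := by
  intro h0
  have h1 := natDegree_le_natDegree (minpoly.degree_le_of_ne_zero (ZMod p) γ hG h0)
  rw [h.natDegree_minpoly (by omega)] at h1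
  omega

theorem injective_natCast_succ (hn : n ≤ p) :
    Function.Injective fun i : Fin n => (((i : ℕ) + 1 : ℕ) : ZMod p) := by
  intro i j hij
  simp only [Nat.cast_add, Nat.cast_one, add_left_inj] at hij
  exact Fin.ext (CharP.natCast_injOn_Iio (ZMod p) p (i.2.trans_le hn) (j.2.trans_le hn) hij)

/-- A nonzero polynomial relation with few terms and small degree does not hold among the points
of a power construction. -/
theorem IsPowConstruction.aeval_powPoints_ne_zero (h : IsPowConstruction k e n p F γ)
    (he : 0 < e) {D : MvPolynomial (Fin n) (ZMod p)} (hD : D ≠ 0) (hdeg : D.totalDegree < k ^ 2)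
    (hcard : D.support.card ^ 2 ≤ e) : MvPolynomial.aeval (powPoints γ e n) D ≠ 0 := by
  set a : Fin n → ZMod p := fun i => (((i : ℕ) + 1 : ℕ) : ZMod p) with ha
  have hainj : Function.Injective a := injective_natCast_succ h.le_prime
  -- The monomial `m` evaluated at the points `(X - i) ^ e` is `P m ^ e`. Distinct monomials give
  -- non-proportional `P m`, by counting roots.
  set P : (Fin n →₀ ℕ) → (ZMod p)[X] := fun m => ∏ i, (X - C (a i)) ^ m i with hP
  have hmonic : ∀ m, (P m).Monic := fun m =>
    monic_prod_of_monic _ _ fun i _ => (monic_X_sub_C _).pow _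
  have hPdeg : ∀ m ∈ D.support, (P m).natDegree ≤ D.totalDegree := fun m hm => by
    rw [hP]
    simp only
    rw [natDegree_prod_of_monic _ _ fun i _ => (monic_X_sub_C _).pow _]
    simp only [natDegree_pow, natDegree_X_sub_C, mul_one]
    refine le_trans (le_of_eq ?_) (MvPolynomial.le_totalDegree hm)
    rw [Finsupp.sum_fintype _ _ fun _ => rfl]
  have hlt : e * D.totalDegree < k ^ 2 * e := by
    rw [mul_comm]; exact Nat.mul_lt_mul_of_pos_right hdeg he
  have hind : LinearIndepOn (ZMod p) (fun m => P m ^ e) (D.support : Set (Fin n →₀ ℕ)) := by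
    refine linearIndepOn_pow p D.support P (fun m _ => (hmonic m).ne_zero) ?_ ?_ hcard
    · intro m _ m' _ hne c hc
      have hc1 : c = 1 := by
        have := congrArg leadingCoeff hc
        rw [leadingCoeff_mul, leadingCoeff_C, (hmonic m).leadingCoeff, (hmonic m').leadingCoeff,
          mul_one] at this
        exact this.symm
      rw [hc1, C_1, one_mul] at hc
      refine hne (Finsupp.ext fun i => ?_)
      rw [← count_roots_prod_X_sub_C_pow a hainj m i, ← count_roots_prod_X_sub_C_pow a hainj m' i]
      exact congrArg (fun f : (ZMod p)[X] => f.roots.count (a i)) hc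
    · intro m hm
      exact ((Nat.mul_le_mul_left e (hPdeg m hm)).trans_lt hlt).trans h.lt_prime
  set G : (ZMod p)[X] := MvPolynomial.aeval (fun i => (X - C (a i)) ^ e) D with hG
  have hGsum : G = ∑ m ∈ D.support, D.coeff m • P m ^ e := by
    rw [hG, MvPolynomial.aeval_def, MvPolynomial.eval₂_eq']
    refine Finset.sum_congr rfl fun m _ => ?_
    rw [Algebra.smul_def, hP]
    simp only
    rw [← Finset.prod_pow]
    congr 1
    exact Finset.prod_congr rfl fun i _ => by rw [← pow_mul, ← pow_mul, mul_comm]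
  have hG0 : G ≠ 0 := by
    intro h0
    rw [hGsum] at h0
    obtain ⟨m, hm⟩ := MvPolynomial.support_nonempty.mpr hD
    exact MvPolynomial.mem_support_iff.mp hm (linearIndepOn_finset_iff.mp hind _ h0 m hm)
  have hGdeg : G.natDegree ≤ e * D.totalDegree := by
    rw [hGsum]
    refine natDegree_sum_le_of_forall_le _ _ fun m hm => ?_
    refine (natDegree_smul_le _ _).trans ?_
    rw [natDegree_pow]
    exact Nat.mul_le_mul_left e (hPdeg m hm)
  have hfin := h.aeval_ne_zero hG0 (hGdeg.trans_lt hlt)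
  have heq : aeval γ G = MvPolynomial.aeval (powPoints γ e n) D := by
    rw [hG, ← AlgHom.comp_apply]
    congr 1
    ext i
    simp [powPoints, ha]
  rwa [← heq]

end Transfer

/-! ### Matching as a linear system, and sending one point to infinity. -/

section MatchingPolynomials

variable {K : Type*} [Field K]

/-- The monomial pairs spanning, modulo diagonal constants, the pairs of polynomials of degree at
most `a` and `b`. -/
noncomputable def monomialPair (K : Type*) [Field K] (a b : ℕ) :
    Option (Fin a ⊕ Fin b) → K[X] × K[X]
  | none => (1, 0)
  | some (Sum.inl r) => (X ^ ((r : ℕ) + 1), 0)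
  | some (Sum.inr r) => (0, -X ^ ((r : ℕ) + 1))

theorem sum_smul_monomialPair (a b : ℕ) (u : Option (Fin a ⊕ Fin b) → K) :
    ∑ c, u c • monomialPair K a b c
      = (C (u none) + ∑ r : Fin a, C (u (some (Sum.inl r))) * X ^ ((r : ℕ) + 1),
        -∑ r : Fin b, C (u (some (Sum.inr r))) * X ^ ((r : ℕ) + 1)) := by
  rw [Fintype.sum_option, Fintype.sum_sum_type]
  ext1
  · simp [monomialPair, smul_eq_C_mul, Prod.fst_sum]
  · simp [monomialPair, smul_eq_C_mul, Prod.snd_sum]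

theorem coeff_sum_C_mul_X_pow_succ {a : ℕ} (w : Fin a → K) (r : Fin a) :
    (∑ i : Fin a, C (w i) * X ^ ((i : ℕ) + 1)).coeff ((r : ℕ) + 1) = w r := by
  rw [finsetSum_coeff]
  simp only [coeff_C_mul, coeff_X_pow, add_left_inj, Fin.val_inj, mul_ite, mul_one, mul_zero,
    Finset.sum_ite_eq, Finset.mem_univ, if_true]

theorem coeff_zero_sum_C_mul_X_pow_succ {a : ℕ} (w : Fin a → K) :
    (∑ i : Fin a, C (w i) * X ^ ((i : ℕ) + 1)).coeff 0 = 0 := by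
  rw [finsetSum_coeff]
  simp [coeff_X_pow]

theorem natDegree_sum_C_mul_X_pow_succ_le {a : ℕ} (w : Fin a → K) :
    (∑ i : Fin a, C (w i) * X ^ ((i : ℕ) + 1)).natDegree ≤ a :=
  natDegree_sum_le_of_forall_le _ _ fun i _ => (natDegree_C_mul_X_pow_le _ _).trans i.2

theorem eq_C_add_sum_of_natDegree_le {a : ℕ} {f : K[X]} (hf : f.natDegree ≤ a) :
    f = C (f.coeff 0) + ∑ i : Fin a, C (f.coeff ((i : ℕ) + 1)) * X ^ ((i : ℕ) + 1) := by
  conv_lhs => rw [f.as_sum_range_C_mul_X_pow' (Nat.lt_succ_of_le hf), Finset.sum_range_succ']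
  rw [add_comm, Finset.sum_range fun i => C (f.coeff (i + 1)) * X ^ (i + 1)]
  simp

/-- Modulo the pairs `(C c, C c)`, which every `η j` kills, the monomial pairs are a basis of the
pairs of bounded degree. -/
theorem det_monomialPair_ne_zero_iff {a b : ℕ} {ρ : Type*} [Fintype ρ] [DecidableEq ρ]
    (ε : ρ ≃ Option (Fin a ⊕ Fin b)) (η : ρ → K[X] × K[X] →ₗ[K] K)
    (hη : ∀ j c, η j (C c, C c) = 0) :
    (Matrix.of fun j c => η j (monomialPair K a b (ε c))).det ≠ 0 ↔
      ∀ f g : K[X], f.natDegree ≤ a → g.natDegree ≤ b → (∀ j, η j (f, g) = 0) →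
        ∃ c, f = C c ∧ g = C c := by
  set M : Matrix ρ ρ K := Matrix.of fun j c => η j (monomialPair K a b (ε c)) with hM
  have hmul : ∀ (u : Option (Fin a ⊕ Fin b) → K) j,
      M.mulVec (u ∘ ε) j = η j (∑ c, u c • monomialPair K a b c) := by
    intro u j
    rw [map_sum, ← Equiv.sum_comp ε, Matrix.mulVec, dotProduct]
    refine Finset.sum_congr rfl fun c _ => ?_
    rw [map_smul, smul_eq_mul, mul_comm]
    rfl
  constructor
  · intro hdet f g hf hg h0
    set u : Option (Fin a ⊕ Fin b) → K := fun
      | none => f.coeff 0 - g.coeff 0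
      | some (Sum.inl r) => f.coeff ((r : ℕ) + 1)
      | some (Sum.inr r) => -g.coeff ((r : ℕ) + 1) with hu
    have hfg : (f, g) = ∑ c, u c • monomialPair K a b c + (C (g.coeff 0), C (g.coeff 0)) := by
      rw [sum_smul_monomialPair, Prod.mk_add_mk]
      ext1
      · conv_lhs => rw [eq_C_add_sum_of_natDegree_le hf]
        simp only [hu, C_sub]
        ring
      · conv_lhs => rw [eq_C_add_sum_of_natDegree_le hg]
        simp only [hu, C_neg, neg_mul, Finset.sum_neg_distrib, neg_neg]
        ring
    have hz : M.mulVec (u ∘ ε) = 0 := by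
      ext j
      have := h0 j
      rw [hfg, map_add, hη, add_zero] at this
      rw [hmul, this, Pi.zero_apply]
    have hu0 : u ∘ ε = 0 := by
      by_contra hne
      exact hdet (Matrix.exists_mulVec_eq_zero_iff.mp ⟨_, hne, hz⟩)
    have hu0' : ∀ c, u c = 0 := fun c => by
      have := congrFun hu0 (ε.symm c)
      simpa using this
    refine ⟨g.coeff 0, ?_, ?_⟩
    · rw [eq_C_add_sum_of_natDegree_le hf, Finset.sum_eq_zero, add_zero,
        sub_eq_zero.mp (hu0' none)]
      intro r _
      rw [show f.coeff ((r : ℕ) + 1) = 0 from hu0' (some (Sum.inl r)), C_0, zero_mul]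
    · conv_lhs => rw [eq_C_add_sum_of_natDegree_le hg]
      rw [Finset.sum_eq_zero, add_zero]
      intro r _
      rw [neg_eq_zero.mp (hu0' (some (Sum.inr r))), C_0, zero_mul]
  · intro H h0
    obtain ⟨w, hw, hMw⟩ := Matrix.exists_mulVec_eq_zero_iff.mpr h0
    set u : Option (Fin a ⊕ Fin b) → K := w ∘ ε.symm with hu
    have hwu : w = u ∘ ε := by ext; simp [hu]
    rw [hwu] at hMw
    have hk : ∀ j, η j (∑ c, u c • monomialPair K a b c) = 0 := fun j => by
      rw [← hmul, hMw, Pi.zero_apply]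
    rw [sum_smul_monomialPair] at hk
    have hd1 := natDegree_add_le_of_degree_le (n := a)
      ((natDegree_C (u none)).le.trans (Nat.zero_le a))
      (natDegree_sum_C_mul_X_pow_succ_le fun r => u (some (Sum.inl r)))
    have hd2 := natDegree_sum_C_mul_X_pow_succ_le fun r => u (some (Sum.inr r))
    rw [← natDegree_neg] at hd2
    obtain ⟨c, hf, hg⟩ := H _ _ hd1 hd2 hk
    have hc : c = 0 := by
      have := congrArg (fun f : K[X] => f.coeff 0) hg
      simp only [coeff_neg, coeff_zero_sum_C_mul_X_pow_succ, coeff_C_zero, neg_zero] at this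
      exact this.symm
    subst hc
    apply hw
    rw [hwu]
    have hall : ∀ c, u c = 0 := by
      rintro (_ | r | r)
      · have := congrArg (fun f : K[X] => f.coeff 0) hf
        simpa only [coeff_add, coeff_zero_sum_C_mul_X_pow_succ, coeff_C_zero, add_zero] using this
      · have := congrArg (fun f : K[X] => f.coeff ((r : ℕ) + 1)) hf
        simpa only [coeff_add, coeff_C_succ, zero_add, coeff_sum_C_mul_X_pow_succ
          (fun r => u (some (Sum.inl r))), C_0, coeff_zero] using this
      · have := congrArg (fun f : K[X] => f.coeff ((r : ℕ) + 1)) hg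
        simpa only [coeff_neg, coeff_sum_C_mul_X_pow_succ
          (fun r => u (some (Sum.inr r))), C_0, coeff_zero, neg_eq_zero] using this
    ext j
    exact hall (ε j)

variable {V ρ : Type*} [DecidableEq V] [DecidableEq ρ]

/-- Only equal constants among the pairs `f, g` of polynomials of degree at most `a` and `b`
satisfy `f (x (I j)) = g (x (J j))` for all `j ∈ E`. -/
def OnlyConstMatch (E : Finset ρ) (I J : ρ → V) (a b : ℕ) (x : V → K) : Prop :=
  ∀ f g : K[X], f.natDegree ≤ a → g.natDegree ≤ b →
    (∀ j ∈ E, f.eval (x (I j)) = g.eval (x (J j))) → ∃ c, f = C c ∧ g = C c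

/-- Let the value at `v` tend to infinity. An equation that involves `v` becomes a condition on a
top coefficient and the others stay. If this limiting system has only constant solutions, the
determinant is a nonzero polynomial in the value at `v`. -/
theorem exists_update_onlyConstMatch [Infinite K] {E : Finset ρ} {I J : ρ → V} {a b : ℕ}
    (hcard : E.card = a + b + 1) (ha : 1 ≤ a) (hb : 1 ≤ b) (v : V) (x : V → K)
    (H : ∀ f g : K[X], f.natDegree ≤ a → g.natDegree ≤ b →
      (∀ j ∈ E, I j ≠ v → J j ≠ v → f.eval (x (I j)) = g.eval (x (J j))) →
      (∀ j ∈ E, I j = v → J j ≠ v → f.coeff a = 0) →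
      (∀ j ∈ E, I j ≠ v → J j = v → g.coeff b = 0) →
      (∀ j ∈ E, I j = v → J j = v → (f - g).coeff (max a b) = 0) → ∃ c, f = C c ∧ g = C c) :
    ∃ t, OnlyConstMatch E I J a b (Function.update x v t) := by
  set y : V → K[X] := fun w => if w = v then X else C (x w) with hy
  have hyv : y v = X := by simp [hy]
  have hyne : ∀ w, w ≠ v → y w = C (x w) := fun w hw => by simp [hy, hw]
  set Φ : E → K[X] × K[X] →ₗ[K] K[X] := fun j =>
    (aeval (y (I j))).toLinearMap ∘ₗ LinearMap.fst K K[X] K[X]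
      - (aeval (y (J j))).toLinearMap ∘ₗ LinearMap.snd K K[X] K[X] with hΦ
  have hΦapp : ∀ j f g, Φ j (f, g) = aeval (y (I j)) f - aeval (y (J j)) g := fun j f g => rfl
  set d : E → ℕ := fun j => if I j = v then (if J j = v then max a b else a)
    else if J j = v then b else 0 with hd
  have hε : Fintype.card E = Fintype.card (Option (Fin a ⊕ Fin b)) := by simp [hcard]
  set ε := Fintype.equivOfCardEq hε
  set M : Matrix E E K[X] := Matrix.of fun j c => Φ j (monomialPair K a b (ε c)) with hM
  have hdeg : ∀ j f g, f.natDegree ≤ a → g.natDegree ≤ b → (Φ j (f, g)).natDegree ≤ d j := by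
    intro j f g hf hg
    rw [hΦapp]
    by_cases h1 : I j = v <;> by_cases h2 : J j = v
    · simp only [hd, h1, h2, hyv, aeval_X_left_apply, if_true]
      exact (natDegree_sub_le _ _).trans (max_le_max hf hg)
    · simp only [hd, h1, h2, hyv, aeval_X_left_apply, if_true, if_false, hyne _ h2]
      rw [← algebraMap_eq, aeval_algebraMap_apply, algebraMap_eq, natDegree_sub_C]
      exact hf
    · simp only [hd, h1, h2, hyv, aeval_X_left_apply, if_true, if_false, hyne _ h1]
      rw [← algebraMap_eq, aeval_algebraMap_apply, algebraMap_eq, natDegree_sub, natDegree_sub_C]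
      exact hg
    · simp only [hd, h1, h2, if_false, hyne _ h1, hyne _ h2]
      rw [← algebraMap_eq, aeval_algebraMap_apply, aeval_algebraMap_apply, algebraMap_eq,
        ← C_sub, natDegree_C]
  have hpair : ∀ c, (monomialPair K a b c).1.natDegree ≤ a ∧
      (monomialPair K a b c).2.natDegree ≤ b := by
    rintro (_ | r | r)
    · simp [monomialPair]
    · simp [monomialPair]
    · simp [monomialPair]
  have hcoeff := Matrix.coeff_det_of_natDegree_le M d fun j c =>
    hdeg j _ _ (hpair (ε c)).1 (hpair (ε c)).2
  set η : E → K[X] × K[X] →ₗ[K] K := fun j => lcoeff K (d j) ∘ₗ Φ j with hη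
  have hdet : (Matrix.of fun j c => η j (monomialPair K a b (ε c))).det ≠ 0 := by
    rw [det_monomialPair_ne_zero_iff ε η fun j c => by
      rw [hη, LinearMap.comp_apply, hΦapp, aeval_C, aeval_C, sub_self, map_zero]]
    intro f g hf hg h0
    have h0' : ∀ j (hj : j ∈ E), (aeval (y (I j)) f - aeval (y (J j)) g).coeff (d ⟨j, hj⟩) = 0 :=
      fun j hj => h0 ⟨j, hj⟩
    refine H f g hf hg ?_ ?_ ?_ ?_ <;> intro j hj h1 h2 <;> have h3 := h0' j hj
    · simp only [hd, h1, h2, if_false, hyne _ h1, hyne _ h2] at h3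
      rw [← algebraMap_eq, aeval_algebraMap_apply, aeval_algebraMap_apply, algebraMap_eq,
        ← C_sub, coeff_C_zero] at h3
      simpa using sub_eq_zero.mp h3
    · simp only [hd, h1, h2, if_true, if_false, hyv, hyne _ h2, aeval_X_left_apply] at h3
      rw [← algebraMap_eq, aeval_algebraMap_apply, algebraMap_eq, coeff_sub, coeff_C,
        -- Here `1 ≤ a` is needed: the constant on the other side must not reach the coefficient at
        -- `a`.
        if_neg (by omega), sub_zero] at h3
      exact h3
    · simp only [hd, h1, h2, if_true, if_false, hyv, hyne _ h1, aeval_X_left_apply] at h3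
      rw [← algebraMap_eq, aeval_algebraMap_apply, algebraMap_eq, coeff_sub, coeff_C,
        if_neg (by omega), zero_sub, neg_eq_zero] at h3
      exact h3
    · simpa only [hd, h1, h2, if_true, hyv, aeval_X_left_apply] using h3
  have hM0 : M.det ≠ 0 := fun h => hdet (by rw [← coeff_zero (∑ i, d i), ← h, hcoeff]; rfl)
  obtain ⟨t, ht⟩ : ∃ t, M.det.eval t ≠ 0 := by
    by_contra hall
    push Not at hall
    exact hM0 (Polynomial.funext fun t => by rw [hall, eval_zero])
  refine ⟨t, ?_⟩
  have hyt : ∀ w, (y w).eval t = Function.update x v t w := fun w => by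
    by_cases hw : w = v
    · subst hw; simp [hyv]
    · simp [hyne w hw, hw]
  set κ : E → K[X] × K[X] →ₗ[K] K := fun j => (leval t) ∘ₗ Φ j with hκ
  have hκapp : ∀ j f g, κ j (f, g) = f.eval (Function.update x v t (I j))
      - g.eval (Function.update x v t (J j)) := fun j f g => by
    have h1 : ∀ (q h : K[X]), eval t (aeval q h) = h.eval (q.eval t) := fun q h => by
      rw [← comp_eq_aeval, eval_comp]
    rw [hκ]
    simp only [LinearMap.comp_apply, hΦapp, leval_apply, eval_sub, h1, hyt]
  have hdetκ : (Matrix.of fun j c => κ j (monomialPair K a b (ε c))).det ≠ 0 := by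
    rw [← coe_evalRingHom, RingHom.map_det] at ht
    exact ht
  rw [det_monomialPair_ne_zero_iff ε κ fun j c => by rw [hκapp]; simp] at hdetκ
  intro f g hf hg h0
  exact hdetκ f g hf hg fun j => by rw [hκapp, h0 j j.2, sub_self]

end MatchingPolynomials

/-! ### Generic matchings, by induction on the edges. -/

section Cycles

variable {V ρ : Type*} [DecidableEq V]

/-- A family of pairwise disjoint nonempty subsets of `E` on each of which `I` and `J` have the same
image. -/
structure IsCycleFamily (E : Finset ρ) (I J : ρ → V) (𝒮 : Finset (Finset ρ)) : Prop where
  subset : ∀ S ∈ 𝒮, S ⊆ E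
  nonempty : ∀ S ∈ 𝒮, S.Nonempty
  image_eq : ∀ S ∈ 𝒮, S.image I = S.image J
  disjoint : (𝒮 : Set (Finset ρ)).PairwiseDisjoint id

theorem IsCycleFamily.mono {E E' : Finset ρ} {I J : ρ → V} {𝒮 : Finset (Finset ρ)}
    (h : IsCycleFamily E' I J 𝒮) (hE : E' ⊆ E) : IsCycleFamily E I J 𝒮 :=
  ⟨fun S hS => (h.subset S hS).trans hE, h.nonempty, h.image_eq, h.disjoint⟩

/-- Every cycle family in `E` has at most `m` members. -/
def CycleBound (E : Finset ρ) (I J : ρ → V) (m : ℕ) : Prop :=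
  ∀ 𝒮, IsCycleFamily E I J 𝒮 → 𝒮.card ≤ m

theorem CycleBound.mono {E E' : Finset ρ} {I J : ρ → V} {m m' : ℕ} (h : CycleBound E I J m)
    (hE : E' ⊆ E) (hm : m ≤ m') : CycleBound E' I J m' :=
  fun 𝒮 h𝒮 => (h 𝒮 (h𝒮.mono hE)).trans hm

theorem CycleBound.symm {E : Finset ρ} {I J : ρ → V} {m : ℕ} (h : CycleBound E I J m) :
    CycleBound E J I m := fun 𝒮 h𝒮 =>
  h 𝒮 ⟨h𝒮.subset, h𝒮.nonempty, fun S hS => (h𝒮.image_eq S hS).symm, h𝒮.disjoint⟩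

theorem exists_source {E : Finset ρ} {I J : ρ → V} (hI : Set.InjOn I (E : Set ρ))
    (hne : E.image I ≠ E.image J) : ∃ j ∈ E, I j ∉ E.image J := by
  by_contra hall
  push Not at hall
  refine hne (Finset.eq_of_subset_of_card_le (Finset.image_subset_iff.mpr hall) ?_)
  rw [Finset.card_image_of_injOn hI]
  exact Finset.card_image_le

variable [DecidableEq ρ]

theorem image_sdiff_subset_of_image_eq {E S U : Finset ρ} {I J : ρ → V}
    (hI : Set.InjOn I (E : Set ρ)) (hS : S ⊆ E) (hU : U ⊆ E) (hSi : S.image I = S.image J)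
    (hUi : U.image I = U.image J) : (S \ U).image I ⊆ (S \ U).image J := by
  intro w hw
  obtain ⟨s, hs, rfl⟩ := Finset.mem_image.mp hw
  rw [Finset.mem_sdiff] at hs
  have h1 : I s ∈ S.image J := hSi ▸ Finset.mem_image_of_mem I hs.1
  obtain ⟨s', hs', h2⟩ := Finset.mem_image.mp h1
  refine Finset.mem_image.mpr ⟨s', Finset.mem_sdiff.mpr ⟨hs', fun hsU => ?_⟩, h2⟩
  have h3 : I s ∈ U.image I := by rw [hUi, ← h2]; exact Finset.mem_image_of_mem J hsU
  obtain ⟨u, hu, h4⟩ := Finset.mem_image.mp h3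
  exact hs.2 (hI (hU hu) (hS hs.1) h4 ▸ hu)

/-- Removing the union of the family from `S` leaves a set with equal images, which still contains
`j`. -/
theorem IsCycleFamily.exists_insert {E E' S : Finset ρ} {I J : ρ → V} {𝒮 : Finset (Finset ρ)}
    (hI : Set.InjOn I (E : Set ρ)) (hJ : Set.InjOn J (E : Set ρ)) (h : IsCycleFamily E' I J 𝒮)
    (hE : E' ⊆ E) (hS : S ⊆ E) (hSi : S.image I = S.image J) {j : ρ} (hj : j ∈ S)
    (hjE : j ∉ E') : ∃ 𝒯, IsCycleFamily E I J 𝒯 ∧ 𝒯.card = 𝒮.card + 1 := by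
  set U := 𝒮.biUnion id with hU
  have hUE' : U ⊆ E' := Finset.biUnion_subset.mpr fun S hS => h.subset S hS
  have hUi : U.image I = U.image J := by
    rw [hU, Finset.biUnion_image, Finset.biUnion_image]
    exact Finset.biUnion_congr rfl fun S hS => h.image_eq S hS
  have hjT : j ∈ S \ U := Finset.mem_sdiff.mpr ⟨hj, fun hjU => hjE (hUE' hjU)⟩
  have hTi : (S \ U).image I = (S \ U).image J :=
    (image_sdiff_subset_of_image_eq hI hS (hUE'.trans hE) hSi hUi).antisymm
      (image_sdiff_subset_of_image_eq hJ hS (hUE'.trans hE) hSi.symm hUi.symm)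
  have hTn : S \ U ∉ 𝒮 := fun hT => hjE (h.subset _ hT hjT)
  have h' := h.mono hE
  refine ⟨insert (S \ U) 𝒮, ⟨?_, ?_, ?_, ?_⟩, Finset.card_insert_of_notMem hTn⟩
  · exact Finset.forall_mem_insert _ _ _ |>.mpr ⟨Finset.sdiff_subset.trans hS, h'.subset⟩
  · exact Finset.forall_mem_insert _ _ _ |>.mpr ⟨⟨j, hjT⟩, h'.nonempty⟩
  · exact Finset.forall_mem_insert _ _ _ |>.mpr ⟨hTi, h'.image_eq⟩
  · rw [Finset.coe_insert]
    refine h'.disjoint.insert fun T hT _ => ?_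
    exact (Finset.disjoint_left.mpr fun a ha haT =>
      (Finset.mem_sdiff.mp ha).2 (Finset.mem_biUnion.mpr ⟨T, hT, haT⟩))

/-- Deleting an edge that lies on a cycle lowers the bound, in step with the drop of `max a b` in
the induction. -/
theorem CycleBound.sub_one {E E' S : Finset ρ} {I J : ρ → V} {m : ℕ} (h : CycleBound E I J m)
    (hI : Set.InjOn I (E : Set ρ)) (hJ : Set.InjOn J (E : Set ρ))
    (hE : E' ⊆ E) (hS : S ⊆ E) (hSi : S.image I = S.image J) {j : ρ} (hj : j ∈ S)
    (hjE : j ∉ E') : CycleBound E' I J (m - 1) := fun 𝒮 h𝒮 => by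
  obtain ⟨𝒯, h𝒯, hc⟩ := h𝒮.exists_insert hI hJ hE hS hSi hj hjE
  have := h 𝒯 h𝒯
  omega

theorem natDegree_le_sub_one {K : Type*} [Field K] {f : K[X]} {a : ℕ}
    (hf : f.natDegree ≤ a) (h : f.coeff a = 0) :
    f.natDegree ≤ a - 1 := by
  rw [natDegree_le_iff_coeff_eq_zero] at hf ⊢
  intro m hm
  rcases (show a ≤ m by omega).eq_or_lt with rfl | hlt
  · exact h
  · exact hf m hlt

variable (K : Type*) [Field K]

/-- Generic points admit only constant matchings, provided that there are few cycles. -/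
def GenericMatch (V ρ : Type*) [DecidableEq V] [DecidableEq ρ] (a b : ℕ) : Prop :=
  ∀ (E : Finset ρ) (I J : ρ → V), Set.InjOn I (E : Set ρ) → Set.InjOn J (E : Set ρ) →
    E.card = a + b + 1 → CycleBound E I J (max a b) → ∃ x : V → K, OnlyConstMatch E I J a b x

theorem GenericMatch.symm {a b : ℕ} (h : GenericMatch K V ρ a b) : GenericMatch K V ρ b a := by
  intro E I J hI hJ hc hb
  obtain ⟨x, hx⟩ := h E J I hJ hI (by omega) (by rw [max_comm]; exact hb.symm)
  refine ⟨x, fun f g hf hg hfg => ?_⟩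
  obtain ⟨c, h1, h2⟩ := hx g f hg hf fun j hj => (hfg j hj).symm
  exact ⟨c, h2, h1⟩

variable [Infinite K]

theorem genericMatch_zero [Finite V] (a : ℕ) : GenericMatch K V ρ a 0 := by
  classical
  intro E I J hI hJ hc _
  cases nonempty_fintype V
  set x : V ↪ K := ((Fintype.equivFin V).toEmbedding.trans Fin.valEmbedding).trans
    (Infinite.natEmbedding K)
  refine ⟨x, fun f g hf hg hfg => ?_⟩
  have hgC := eq_C_of_natDegree_eq_zero (Nat.le_zero.mp hg)
  have h0 : f - g = 0 := by
    refine eq_zero_of_natDegree_lt_card_of_eval_eq_zero' _ (E.image fun j => x (I j)) ?_ ?_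
    · intro y hy
      obtain ⟨j, hj, rfl⟩ := Finset.mem_image.mp hy
      rw [eval_sub, hfg j hj, hgC, eval_C, eval_C, sub_self]
    · rw [Finset.card_image_of_injOn fun i hi j hj hij => hI hi hj (x.injective hij), hc, hgC,
        natDegree_sub_C]
      omega
  exact ⟨g.coeff 0, (sub_eq_zero.mp h0).trans hgC, hgC⟩

/-- Sending a vertex with no incoming edge to infinity kills the top coefficient of `f` at the cost
of one edge. -/
theorem genericMatch_of_source {a b : ℕ} (hb1 : 1 ≤ b) (ha1 : 1 ≤ a)
    (ih : GenericMatch K V ρ (a - 1) b) {E : Finset ρ} {I J : ρ → V}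
    (hI : Set.InjOn I (E : Set ρ)) (hJ : Set.InjOn J (E : Set ρ)) (hc : E.card = a + b + 1)
    {j : ρ} (hj : j ∈ E) (hsrc : I j ∉ E.image J)
    (hB : CycleBound (E.erase j) I J (max (a - 1) b)) :
    ∃ x : V → K, OnlyConstMatch E I J a b x := by
  have hsub : ((E.erase j : Finset ρ) : Set ρ) ⊆ E := Finset.coe_subset.mpr (Finset.erase_subset j E)
  obtain ⟨x, hx⟩ := ih (E.erase j) I J (hI.mono hsub) (hJ.mono hsub)
    (by rw [Finset.card_erase_of_mem hj]; omega) hB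
  have hJne : ∀ i ∈ E, J i ≠ I j := fun i hi h => hsrc (h ▸ Finset.mem_image_of_mem J hi)
  obtain ⟨t, ht⟩ := exists_update_onlyConstMatch hc ha1 hb1 (I j) x
    fun f g hf hg h1 h2 _ _ => by
      refine hx f g (natDegree_le_sub_one hf (h2 j hj rfl (hJne j hj))) hg fun i hi => ?_
      have hiE := Finset.mem_of_mem_erase hi
      exact h1 i hiE (fun h => Finset.ne_of_mem_erase hi (hI hiE hj h)) (hJne i hiE)
  exact ⟨_, ht⟩

/-- At a loop the limit sees the top coefficient of `f - g`; since `b < a`, it is that of `f`. -/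
theorem genericMatch_of_loop {a b : ℕ} (hb1 : 1 ≤ b) (hab : b < a)
    (ih : GenericMatch K V ρ (a - 1) b) {E : Finset ρ} {I J : ρ → V}
    (hI : Set.InjOn I (E : Set ρ)) (hJ : Set.InjOn J (E : Set ρ)) (hc : E.card = a + b + 1)
    {j : ρ} (hj : j ∈ E) (hloop : I j = J j)
    (hB : CycleBound (E.erase j) I J (max (a - 1) b)) :
    ∃ x : V → K, OnlyConstMatch E I J a b x := by
  have hsub : ((E.erase j : Finset ρ) : Set ρ) ⊆ E := Finset.coe_subset.mpr (Finset.erase_subset j E)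
  obtain ⟨x, hx⟩ := ih (E.erase j) I J (hI.mono hsub) (hJ.mono hsub)
    (by rw [Finset.card_erase_of_mem hj]; omega) hB
  obtain ⟨t, ht⟩ := exists_update_onlyConstMatch hc (by omega) hb1 (I j) x
    fun f g hf hg h1 _ _ h4 => by
      have h5 := h4 j hj rfl hloop.symm
      rw [max_eq_left hab.le, coeff_sub, coeff_eq_zero_of_natDegree_lt (hg.trans_lt hab),
        sub_zero] at h5
      refine hx f g (natDegree_le_sub_one hf h5) hg fun i hi => ?_
      have hiE := Finset.mem_of_mem_erase hi
      exact h1 i hiE (fun h => Finset.ne_of_mem_erase hi (hI hiE hj h))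
        (fun h => Finset.ne_of_mem_erase hi (hJ hiE hj (h.trans hloop)))
  exact ⟨_, ht⟩

/-- A vertex with distinct incoming and outgoing edges costs two edges and lowers both degrees. -/
theorem genericMatch_of_passing {a b : ℕ} (hb1 : 1 ≤ b) (ha1 : 1 ≤ a)
    (ih : GenericMatch K V ρ (a - 1) (b - 1)) {E : Finset ρ} {I J : ρ → V}
    (hI : Set.InjOn I (E : Set ρ)) (hJ : Set.InjOn J (E : Set ρ)) (hc : E.card = a + b + 1)
    {j j' : ρ} (hj : j ∈ E) (hj' : j' ∈ E) (hne : I j ≠ J j) (hpass : J j' = I j)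
    (hB : CycleBound ((E.erase j).erase j') I J (max (a - 1) (b - 1))) :
    ∃ x : V → K, OnlyConstMatch E I J a b x := by
  have hjj' : j' ≠ j := fun h => hne (by rw [← hpass, h])
  have hsub : (((E.erase j).erase j' : Finset ρ) : Set ρ) ⊆ E :=
    Finset.coe_subset.mpr ((Finset.erase_subset _ _).trans (Finset.erase_subset j E))
  have hj'e : j' ∈ E.erase j := Finset.mem_erase.mpr ⟨hjj', hj'⟩
  obtain ⟨x, hx⟩ := ih _ I J (hI.mono hsub) (hJ.mono hsub)
    (by rw [Finset.card_erase_of_mem hj'e, Finset.card_erase_of_mem hj]; omega) hB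
  obtain ⟨t, ht⟩ := exists_update_onlyConstMatch hc ha1 hb1 (I j) x
    fun f g hf hg h1 h2 h3 _ => by
      refine hx f g (natDegree_le_sub_one hf (h2 j hj rfl hne.symm))
        (natDegree_le_sub_one hg (h3 j' hj' (fun h => hjj' (hI hj' hj h)) hpass)) fun i hi => ?_
      have hi1 := Finset.mem_of_mem_erase hi
      have hiE := Finset.mem_of_mem_erase hi1
      exact h1 i hiE (fun h => Finset.ne_of_mem_erase hi1 (hI hiE hj h))
        (fun h => Finset.ne_of_mem_erase hi (hJ hiE hj' (h.trans hpass.symm)))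
  exact ⟨_, ht⟩

theorem genericMatch_of_le [Finite V] {a b : ℕ} (hab : b ≤ a)
    (ih : ∀ a' b', a' + b' < a + b → GenericMatch K V ρ a' b') : GenericMatch K V ρ a b := by
  rcases Nat.eq_zero_or_pos b with rfl | hb1
  · exact genericMatch_zero K a
  intro E I J hI hJ hc hB
  by_cases hP : ∃ S ⊆ E, S.image I = S.image J ∧ ∃ j ∈ S, I j ≠ J j
  · obtain ⟨S, hS, hSi, j, hj, hne⟩ := hP
    have h1 : I j ∈ S.image J := hSi ▸ Finset.mem_image_of_mem I hj
    obtain ⟨j', hj', hpass⟩ := Finset.mem_image.mp h1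
    refine genericMatch_of_passing K hb1 (by omega) (ih _ _ (by omega)) hI hJ hc (hS hj) (hS hj')
      hne hpass ?_
    refine (hB.sub_one hI hJ ((Finset.erase_subset _ _).trans (Finset.erase_subset j E)) hS hSi hj
      (by simp)).mono subset_rfl (by omega)
  have hloop : ∀ S ⊆ E, S.image I = S.image J → ∀ j ∈ S, I j = J j := by
    intro S hS hSi j hj
    by_contra hne
    exact hP ⟨S, hS, hSi, j, hj, hne⟩
  -- All cycles are now loops. If `a = b`, the cycle bound may stay, since `max (a - 1) a = a`. More
  -- than `a` edges cannot all be loops, so the non-loops contain a source.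
  rcases hab.eq_or_lt with rfl | hlt
  · set N := E.filter fun j => I j ≠ J j with hN
    have hNE : N ⊆ E := Finset.filter_subset _ _
    have hNne : N.image I ≠ N.image J := by
      intro hNi
      have hall : ∀ j ∈ E, I j = J j := fun j hj => by
        by_contra hne
        exact hne (hloop N hNE hNi j (Finset.mem_filter.mpr ⟨hj, hne⟩))
      have := hB (E.image fun j => {j}) ⟨?_, ?_, ?_, ?_⟩
      · rw [Finset.card_image_of_injective _ Finset.singleton_injective, hc] at this
        omega
      · simp
      · simp
      · simpa using hall
      · intro S hS T hT hST
        simp only [Finset.coe_image, Set.mem_image, Finset.mem_coe] at hS hT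
        obtain ⟨i, _, rfl⟩ := hS
        obtain ⟨j, _, rfl⟩ := hT
        simpa [Function.onFun] using fun h : i = j => hST (by rw [h])
    obtain ⟨j, hj, hsrc⟩ := exists_source (hI.mono (Finset.coe_subset.mpr hNE)) hNne
    refine genericMatch_of_source K hb1 hb1 (ih _ _ (by omega)) hI hJ hc (hNE hj) ?_
      (hB.mono (Finset.erase_subset j E) (by omega))
    intro hmem
    obtain ⟨i, hi, hij⟩ := Finset.mem_image.mp hmem
    by_cases hiN : I i = J i
    · have : i = j := hI hi (hNE hj) (hiN.trans hij)
      subst this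
      exact (Finset.mem_filter.mp hj).2 hiN
    · exact hsrc (Finset.mem_image.mpr ⟨i, Finset.mem_filter.mpr ⟨hi, hiN⟩, hij⟩)
  -- If `b < a`, the bound must drop to `a - 1`: a loop is removed if there is one, and otherwise
  -- there are no cycles at all.
  · by_cases hQ : ∃ S ⊆ E, S.image I = S.image J ∧ S.Nonempty
    · obtain ⟨S, hS, hSi, j, hj⟩ := hQ
      refine genericMatch_of_loop K hb1 hlt (ih _ _ (by omega)) hI hJ hc (hS hj)
        (hloop S hS hSi j hj) ?_
      exact (hB.sub_one hI hJ (Finset.erase_subset j E) hS hSi hj (by simp)).mono subset_rfl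
        (by omega)
    · have hnone : ∀ S ⊆ E, S.image I = S.image J → ¬ S.Nonempty :=
        fun S hS hSi hn => hQ ⟨S, hS, hSi, hn⟩
      have hEn : E.Nonempty := Finset.card_pos.mp (by omega)
      obtain ⟨j, hj, hsrc⟩ := exists_source hI fun h => hnone E subset_rfl h hEn
      refine genericMatch_of_source K hb1 (by omega) (ih _ _ (by omega)) hI hJ hc hj hsrc ?_
      intro 𝒮 h𝒮
      have h𝒮' := h𝒮.mono (Finset.erase_subset j E)
      have : 𝒮 = ∅ := Finset.eq_empty_of_forall_notMem fun S hS =>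
        hnone S (h𝒮'.subset S hS) (h𝒮'.image_eq S hS) (h𝒮'.nonempty S hS)
      simp [this]

theorem genericMatch [Finite V] (a b : ℕ) : GenericMatch K V ρ a b := by
  induction h : a + b using Nat.strong_induction_on generalizing a b with
  | _ N ih =>
  rcases le_total b a with hab | hab
  · exact genericMatch_of_le K hab fun a' b' hlt => ih _ (h ▸ hlt) a' b' rfl
  · exact (genericMatch_of_le K hab fun a' b' hlt => ih _ (by omega) a' b' rfl).symm

end Cycles

/-! ### Number of terms and degree of determinants with sums of monomials as entries. -/

section MvDet

variable {R σ τ ρ : Type*} [CommRing R] [Fintype ρ] [DecidableEq ρ]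

theorem card_support_prod_sum_monomial_le {ι : Type*} [Fintype ι] [DecidableEq ι]
    (S : ι → Finset τ) (ex : ι → τ → (σ →₀ ℕ)) :
    (∏ i, ∑ v ∈ S i, MvPolynomial.monomial (ex i v) (1 : R)).support.card ≤ ∏ i, (S i).card := by
  classical
  rw [Finset.prod_univ_sum]
  refine (Finset.card_le_card MvPolynomial.support_sum).trans (Finset.card_biUnion_le.trans ?_)
  rw [← Fintype.card_piFinset, Finset.card_eq_sum_ones]
  refine Finset.sum_le_sum fun w _ => ?_
  rw [← MvPolynomial.monomial_sum_one]
  exact (Finset.card_le_card MvPolynomial.support_monomial_subset).trans (by simp)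

theorem card_support_det_le (S : ρ → Finset τ) (ex : ρ → ρ → τ → (σ →₀ ℕ)) :
    (Matrix.of fun i c => ∑ v ∈ S i, MvPolynomial.monomial (ex i c v) (1 : R)).det.support.card
      ≤ (Fintype.card ρ)! * ∏ i, (S i).card := by
  classical
  rw [Matrix.det_apply]
  refine (Finset.card_le_card MvPolynomial.support_sum).trans (Finset.card_biUnion_le.trans ?_)
  rw [← Fintype.card_perm, ← smul_eq_mul]
  refine Finset.sum_le_card_nsmul _ _ _ fun π _ => ?_
  have h1 := card_support_prod_sum_monomial_le (R := R) (fun i => S (π i))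
    fun i v => ex (π i) i v
  rw [Equiv.prod_comp π fun i => (S i).card] at h1
  rcases Int.units_eq_one_or (Equiv.Perm.sign π) with hs | hs
  · rw [hs, one_smul]; exact h1
  · rw [hs, Units.neg_smul, one_smul, MvPolynomial.support_neg]; exact h1

theorem totalDegree_det_le (M : Matrix ρ ρ (MvPolynomial σ R)) (w : ρ → ℕ)
    (h : ∀ i c, (M i c).totalDegree ≤ w c) : M.det.totalDegree ≤ ∑ c, w c := by
  rw [Matrix.det_apply]
  refine MvPolynomial.totalDegree_finsetSum_le fun π _ => ?_
  have h1 : (∏ i, M (π i) i).totalDegree ≤ ∑ c, w c :=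
    (MvPolynomial.totalDegree_finsetProd _ _).trans (Finset.sum_le_sum fun i _ => h _ i)
  rcases Int.units_eq_one_or (Equiv.Perm.sign π) with hs | hs
  · rw [hs, one_smul]; exact h1
  · rw [hs, Units.neg_smul, one_smul, MvPolynomial.totalDegree_neg]; exact h1

end MvDet

/-! ### The matching determinant. -/

section MatchMatrix

/-- The exponents of the generic matching matrix. -/
noncomputable def matchExponent {V : Type*} {a b : ℕ} (v w : V) :
    Option (Fin a ⊕ Fin b) → (V →₀ ℕ)
  | none => 0
  | some (Sum.inl r) => Finsupp.single v ((r : ℕ) + 1)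
  | some (Sum.inr r) => Finsupp.single w ((r : ℕ) + 1)

/-- The degrees of the columns of the generic matching matrix. -/
def matchWeight {a b : ℕ} : Option (Fin a ⊕ Fin b) → ℕ
  | none => 0
  | some (Sum.inl r) => (r : ℕ) + 1
  | some (Sum.inr r) => (r : ℕ) + 1

/-- The determinant expressing that `f (x (I j)) = g (x (J j))` has only constant solutions. -/
noncomputable def matchDet {V ρ : Type*} [Fintype ρ] [DecidableEq ρ] (R : Type*) [CommRing R]
    {a b : ℕ} (ε : ρ ≃ Option (Fin a ⊕ Fin b)) (I J : ρ → V) : MvPolynomial V R :=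
  (Matrix.of fun j c => ∑ _v ∈ ({()} : Finset Unit),
    MvPolynomial.monomial (matchExponent (I j) (J j) (ε c)) (1 : R)).det

variable {V ρ : Type*} [Fintype ρ] [DecidableEq ρ] {R : Type*} [CommRing R] {a b : ℕ}
  (ε : ρ ≃ Option (Fin a ⊕ Fin b)) (I J : ρ → V)

theorem card_support_matchDet_le :
    (matchDet R ε I J).support.card ≤ (Fintype.card ρ)! := by
  refine (card_support_det_le _ _).trans ?_
  simp

theorem two_mul_sum_fin_succ (a : ℕ) : 2 * ∑ r : Fin a, ((r : ℕ) + 1) = a * (a + 1) := by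
  induction a with
  | zero => simp
  | succ a ih =>
    rw [Fin.sum_univ_castSucc, mul_add]
    simp only [Fin.val_castSucc, Fin.val_last]
    rw [ih]
    ring

theorem totalDegree_matchDet_le :
    2 * (matchDet R ε I J).totalDegree ≤ a * (a + 1) + b * (b + 1) := by
  have h : (matchDet R ε I J).totalDegree ≤ ∑ c, matchWeight (ε c) := by
    refine totalDegree_det_le _ _ fun j c => ?_
    simp only [Finset.sum_singleton, Matrix.of_apply]
    refine (MvPolynomial.totalDegree_monomial_le _ _).trans (le_of_eq ?_)
    rcases ε c with _ | r | r <;>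
      simp [matchExponent, matchWeight, -Finsupp.single_add]
  rw [Equiv.sum_comp ε matchWeight, Fintype.sum_option, Fintype.sum_sum_type] at h
  simp only [matchWeight] at h
  have h1 := two_mul_sum_fin_succ a
  have h2 := two_mul_sum_fin_succ b
  omega

/-- The functional `(f, g) ↦ f y - g z`. -/
noncomputable def evalDiff {L : Type*} [Field L] (y z : L) : L[X] × L[X] →ₗ[L] L :=
  (leval y) ∘ₗ LinearMap.fst L L[X] L[X] - (leval z) ∘ₗ LinearMap.snd L L[X] L[X]

theorem evalDiff_apply {L : Type*} [Field L] (y z : L) (f g : L[X]) :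
    evalDiff y z (f, g) = f.eval y - g.eval z := rfl

theorem aeval_matchDet {L : Type*} [Field L] [Algebra R L] (x : V → L) :
    MvPolynomial.aeval x (matchDet R ε I J)
      = (Matrix.of fun j c => evalDiff (x (I j)) (x (J j)) (monomialPair L a b (ε c))).det := by
  rw [matchDet, AlgHom.map_det]
  congr 1
  ext j c
  simp only [AlgHom.mapMatrix_apply, Matrix.map_apply, Matrix.of_apply, Finset.sum_singleton]
  -- The sign in `monomialPair` cancels that of `evalDiff`, so every entry is a monomial with
  -- coefficient `1`.
  rcases ε c with _ | r | r <;>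
    simp [matchExponent, monomialPair, evalDiff_apply, MvPolynomial.aeval_monomial,
      -Finsupp.single_add]

theorem aeval_matchDet_ne_zero_iff {L : Type*} [Field L] [Algebra R L] (x : V → L) :
    MvPolynomial.aeval x (matchDet R ε I J) ≠ 0 ↔ OnlyConstMatch Finset.univ I J a b x := by
  rw [aeval_matchDet, det_monomialPair_ne_zero_iff ε (fun j => evalDiff (x (I j)) (x (J j)))
    fun j c => by simp [evalDiff_apply]]
  simp [OnlyConstMatch, evalDiff_apply, sub_eq_zero]

end MatchMatrix

/-! ### The power sum determinant. -/

section PowerSums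

/-- The determinant of the power sums over the sets `T t`. -/
noncomputable def powerSumDet {V : Type*} (R : Type*) [CommRing R] {k : ℕ}
    (T : Fin k → Finset V) : MvPolynomial V R :=
  (Matrix.of fun t r : Fin k =>
    ∑ v ∈ T t, MvPolynomial.monomial (Finsupp.single v (r : ℕ)) (1 : R)).det

variable {V R : Type*} [CommRing R] {k : ℕ} (T : Fin k → Finset V)

theorem card_support_powerSumDet_le :
    (powerSumDet R T).support.card ≤ k ! * ∏ t, (T t).card := by
  refine (card_support_det_le T fun t r v => Finsupp.single v (r : ℕ)).trans ?_
  simp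

theorem totalDegree_powerSumDet_le : (powerSumDet R T).totalDegree ≤ k * (k - 1) := by
  have h : (powerSumDet R T).totalDegree ≤ ∑ r : Fin k, (r : ℕ) := by
    refine totalDegree_det_le _ _ fun j c => ?_
    simp only [Matrix.of_apply]
    refine MvPolynomial.totalDegree_finsetSum_le fun v _ => ?_
    exact (MvPolynomial.totalDegree_monomial_le _ _).trans (by simp)
  refine h.trans ((Finset.sum_le_card_nsmul _ _ (k - 1) fun r _ => ?_).trans (by simp))
  have := r.2
  omega

theorem aeval_powerSumDet {L : Type*} [Field L] [Algebra R L] (x : V → L) :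
    MvPolynomial.aeval x (powerSumDet R T)
      = (Matrix.of fun t r : Fin k => ∑ v ∈ T t, x v ^ (r : ℕ)).det := by
  rw [powerSumDet, AlgHom.map_det]
  congr 1
  ext j c
  simp [MvPolynomial.aeval_monomial]

theorem aeval_powerSumDet_ne_zero_iff {L : Type*} [Field L] [Algebra R L] (x : V → L) :
    MvPolynomial.aeval x (powerSumDet R T) ≠ 0 ↔
      ∀ u : Fin k → L, (∀ t, ∑ v ∈ T t, ∑ r, u r * x v ^ (r : ℕ) = 0) → u = 0 := by
  rw [aeval_powerSumDet, Ne, ← Matrix.exists_mulVec_eq_zero_iff]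
  have h : ∀ u t, (Matrix.of fun t r : Fin k => ∑ v ∈ T t, x v ^ (r : ℕ)).mulVec u t
      = ∑ v ∈ T t, ∑ r, u r * x v ^ (r : ℕ) := fun u t => by
    rw [Finset.sum_comm, Matrix.mulVec, dotProduct]
    exact Finset.sum_congr rfl fun r _ => by rw [Matrix.of_apply, ← Finset.mul_sum, mul_comm]
  constructor
  · intro hne u hu
    by_contra hu0
    exact hne ⟨u, hu0, funext fun t => by rw [h, hu, Pi.zero_apply]⟩
  · rintro H ⟨u, hu0, hu⟩
    exact hu0 (H u fun t => by rw [← h, hu, Pi.zero_apply])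

theorem powerSumDet_ne_zero [DecidableEq V] (p : ℕ) [Fact p.Prime] (hkp : k ≤ p)
    (hT : ∀ t, (T t).Nonempty) (hdisj : ∀ s t, s ≠ t → Disjoint (T s) (T t))
    (hcard : ∀ t, (T t).card < p) : powerSumDet (ZMod p) T ≠ 0 := by
  rcases Nat.eq_zero_or_pos k with rfl | hk
  · simp [powerSumDet]
  choose rep hrep using hT
  have hrepT : ∀ s t, rep s ∈ T t → s = t := fun s t h => by
    by_contra hne
    exact Finset.disjoint_left.mp (hdisj s t hne) (hrep s) h
  -- One representative of `T t` gets the value `t`, every other point gets `0`. Row `0` then reads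
  -- `|T 0| * u 0 = 0`, which forces `u 0 = 0`, and a Vandermonde system remains.
  set x : V → ZMod p := fun v => ∑ t, if v = rep t then ((t : ℕ) : ZMod p) else 0 with hx
  have hxrep : ∀ t, x (rep t) = ((t : ℕ) : ZMod p) := fun t => by
    rw [hx]
    simp only
    rw [Finset.sum_eq_single t _ (by simp), if_pos rfl]
    intro s _ hs
    rw [if_neg]
    intro h
    exact hs (hrepT s t (h ▸ hrep t))
  have hxne : ∀ t, ∀ v ∈ T t, v ≠ rep t → x v = 0 := fun t v hv hne => by
    refine Finset.sum_eq_zero fun s _ => if_neg fun h => ?_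
    have := hrepT s t (h ▸ hv)
    exact hne (this ▸ h)
  have key : MvPolynomial.aeval x (powerSumDet (ZMod p) T) ≠ 0 := by
    rw [aeval_powerSumDet_ne_zero_iff]
    intro u hu
    have h0 : ∀ z : ZMod p, z = 0 → ∑ r, u r * z ^ (r : ℕ) = u ⟨0, hk⟩ := by
      rintro z rfl
      rw [Finset.sum_eq_single ⟨0, hk⟩ _ (by simp)]
      · simp
      · intro r _ hr
        rw [zero_pow fun h => hr (Fin.ext h), mul_zero]
    have hsplit : ∀ t : Fin k, ∑ r, u r * ((t : ℕ) : ZMod p) ^ (r : ℕ)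
        + (((T t).card - 1 : ℕ) : ZMod p) * u ⟨0, hk⟩ = 0 := fun t => by
      rw [← hu t, ← Finset.add_sum_erase _ _ (hrep t), hxrep,
        Finset.sum_congr rfl fun v hv => h0 (x v) (hxne t v (Finset.mem_of_mem_erase hv)
          (Finset.ne_of_mem_erase hv)), Finset.sum_const, Finset.card_erase_of_mem (hrep t),
        nsmul_eq_mul]
    have hu0 : u ⟨0, hk⟩ = 0 := by
      have h1 := hsplit ⟨0, hk⟩
      rw [h0 _ (by simp)] at h1
      have hpos : 0 < (T ⟨0, hk⟩).card := Finset.card_pos.mpr ⟨_, hrep _⟩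
      have h2 : (((T ⟨0, hk⟩).card : ℕ) : ZMod p) * u ⟨0, hk⟩ = 0 := by
        rw [← h1, Nat.cast_sub hpos]; push_cast; ring
      refine (mul_eq_zero.mp h2).resolve_left fun h3 => ?_
      rw [ZMod.natCast_eq_zero_iff] at h3
      exact absurd (Nat.le_of_dvd hpos h3) (not_le.mpr (hcard _))
    have hv : (Matrix.vandermonde fun t : Fin k => ((t : ℕ) : ZMod p)).mulVec u = 0 := by
      ext t
      have h1 := hsplit t
      rw [hu0, mul_zero, add_zero] at h1
      rw [Pi.zero_apply, ← h1, Matrix.mulVec, dotProduct]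
      exact Finset.sum_congr rfl fun r _ => by rw [Matrix.vandermonde_apply, mul_comm]
    by_contra hne
    refine Matrix.det_vandermonde_ne_zero_iff.mpr ?_
      (Matrix.exists_mulVec_eq_zero_iff.mp ⟨u, hne, hv⟩)
    intro s t hst
    exact Fin.ext (CharP.natCast_injOn_Iio (ZMod p) p (s.2.trans_le hkp) (t.2.trans_le hkp) hst)
  intro h
  rw [h, map_zero] at key
  exact key rfl

end PowerSums

/-! ### Uniqueness from `2k - 1` matched pairs. -/

section Matching

variable {k e n p : ℕ} [Fact p.Prime] {F : Type*} [Field F] [Algebra (ZMod p) F] {γ : F}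

/-- Since `m t ≤ 2 ^ (m t - 1)` and the excesses `m t - 1` add up to at most `k - 1`, the product is
at most `2 ^ (k - 1)`. -/
theorem factorial_mul_prod_le {k : ℕ} (hk : 1 ≤ k) (m : Fin k → ℕ) (hpos : ∀ t, 1 ≤ m t)
    (hsum : ∑ t, m t ≤ 2 * k - 1) : k ! * ∏ t, m t ≤ (2 * k - 1)! := by
  have h1 : ∏ t, m t ≤ 2 ^ (k - 1) := by
    calc ∏ t, m t ≤ ∏ t, 2 ^ (m t - 1) := Finset.prod_le_prod' fun t _ => by
          have := hpos t
          have h2 := (m t - 1).lt_two_pow_self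
          omega
      _ = 2 ^ ∑ t, (m t - 1) := Finset.prod_pow_eq_pow_sum _ _ _
      _ ≤ 2 ^ (k - 1) := by
          refine Nat.pow_le_pow_right (by norm_num) ?_
          have h3 : ∑ t, m t = ∑ t, (m t - 1) + k := by
            have h4 : ∑ _t : Fin k, 1 = k := by simp
            have h5 : ∑ t, m t = ∑ t, (m t - 1 + 1) :=
              Finset.sum_congr rfl fun t _ => by have := hpos t; omega
            rw [h5, Finset.sum_add_distrib, h4]
          omega
  calc k ! * ∏ t, m t ≤ k ! * (k + 1) ^ (k - 1) :=
        Nat.mul_le_mul_left _ (h1.trans (Nat.pow_le_pow_left (by omega) _))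
    _ ≤ (k + (k - 1))! := Nat.factorial_mul_pow_le_factorial
    _ = (2 * k - 1)! := by congr 1; omega

/-- Two polynomials of degree less than `k` which agree on `2 k - 1` matched pairs of points of a
power construction are equal. -/
theorem IsPowConstruction.eq_of_match (h : IsPowConstruction k e n p F γ) (hk : 1 ≤ k)
    (he : ((2 * k - 1)!) ^ 2 ≤ e) {f g : F[X]} (hf : f.degree < k) (hg : g.degree < k)
    {I J : Fin (2 * k - 1) → Fin n} (hI : Function.Injective I) (hJ : Function.Injective J)
    (hIJ : ∀ j, f.eval (powPoints γ e n (I j)) = g.eval (powPoints γ e n (J j))) : f = g := by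
  have he0 : 0 < e := (pow_pos (Nat.factorial_pos _) 2).trans_le he
  have hfd : f.natDegree < k := by
    rcases eq_or_ne f 0 with rfl | h0
    · rw [natDegree_zero]; exact hk
    · exact (natDegree_lt_iff_degree_lt h0).mpr hf
  have hgd : g.natDegree < k := by
    rcases eq_or_ne g 0 with rfl | h0
    · rw [natDegree_zero]; exact hk
    · exact (natDegree_lt_iff_degree_lt h0).mpr hg
  have hp : 2 * k - 1 < p := by
    refine lt_of_le_of_lt ?_ h.lt_prime
    calc 2 * k - 1 ≤ (2 * k - 1)! := Nat.self_le_factorial _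
      _ ≤ ((2 * k - 1)!) ^ 2 := Nat.le_self_pow (by norm_num) _
      _ ≤ e := he
      _ ≤ k ^ 2 * e := Nat.le_mul_of_pos_left _ (pow_pos hk 2)
  by_cases hB : CycleBound Finset.univ I J (k - 1)
  -- The algebraic closure serves as an infinite field of characteristic `p`, where one good point
  -- certifies that the determinant over `ZMod p` is nonzero.
  · obtain ⟨x, hx⟩ := genericMatch (AlgebraicClosure (ZMod p)) (k - 1) (k - 1) Finset.univ I J
      hI.injOn hJ.injOn (by simp; omega) (by simpa using hB)
    have hε : Fintype.card (Fin (2 * k - 1)) = Fintype.card (Option (Fin (k - 1) ⊕ Fin (k - 1))) := by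
      simp; omega
    set ε := Fintype.equivOfCardEq hε
    have hD : matchDet (ZMod p) ε I J ≠ 0 := fun h0 => by
      refine (aeval_matchDet_ne_zero_iff (R := ZMod p) ε I J x).mpr hx ?_
      rw [h0, map_zero]
    have hne := h.aeval_powPoints_ne_zero he0 hD
      (by
        have h1 := totalDegree_matchDet_le (R := ZMod p) ε I J
        obtain ⟨l, rfl⟩ : ∃ l, k = l + 1 := ⟨k - 1, by omega⟩
        simp only [Nat.add_sub_cancel] at h1
        nlinarith)
      ((Nat.pow_le_pow_left (card_support_matchDet_le ε I J) 2).trans (by simpa using he))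
    rw [aeval_matchDet_ne_zero_iff] at hne
    obtain ⟨c, h1, h2⟩ := hne f g (by omega) (by omega) fun j _ => hIJ j
    rw [h1, h2]
  · simp only [CycleBound, not_forall, not_le] at hB
    obtain ⟨𝒮, h𝒮, hcard⟩ := hB
    obtain ⟨S⟩ : Nonempty (Fin k ↪ 𝒮) :=
      Function.Embedding.nonempty_of_card_le (by simp; omega)
    set T : Fin k → Finset (Fin n) := fun t => (S t).1.image I with hT
    have hTcard : ∀ t, (T t).card = (S t).1.card := fun t => Finset.card_image_of_injective _ hI
    have hSdisj : ∀ s t, s ≠ t → Disjoint (S s).1 (S t).1 := fun s t hst =>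
      h𝒮.disjoint (S s).2 (S t).2 fun heq => hst (S.injective (Subtype.ext heq))
    have hSpos : ∀ t, 1 ≤ (S t).1.card := fun t => Finset.card_pos.mpr (h𝒮.nonempty _ (S t).2)
    have hSsum : ∑ t, (S t).1.card ≤ 2 * k - 1 := by
      rw [← Finset.card_biUnion fun s _ t _ hst => hSdisj s t hst]
      exact (Finset.card_le_univ _).trans (by simp)
    have hD : powerSumDet (ZMod p) T ≠ 0 := by
      refine powerSumDet_ne_zero T p (by omega) ?_ ?_ ?_
      · exact fun t => (h𝒮.nonempty _ (S t).2).image I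
      · exact fun s t hst => (Finset.disjoint_image hI).mpr (hSdisj s t hst)
      · intro t
        rw [hTcard]
        exact ((Finset.card_le_univ _).trans (by simp)).trans_lt hp
    have hne := h.aeval_powPoints_ne_zero he0 hD
      (by
        refine (totalDegree_powerSumDet_le T).trans_lt ?_
        rw [sq]
        exact Nat.mul_lt_mul_of_pos_left (by omega) hk)
      ((Nat.pow_le_pow_left ((card_support_powerSumDet_le T).trans (by
        simp only [hTcard]
        exact factorial_mul_prod_le hk _ hSpos hSsum)) 2).trans he)
    rw [aeval_powerSumDet_ne_zero_iff] at hne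
    have hd : (f - g).natDegree < k := (natDegree_sub_le _ _).trans_lt (max_lt hfd hgd)
    -- On each cycle `I` and `J` run through the same points, so `f` and `g` have equal sums over
    -- them.
    have hu := hne (fun r => (f - g).coeff r) fun t => by
      have h1 : ∀ v, ∑ r : Fin k, (f - g).coeff r * powPoints γ e n v ^ (r : ℕ)
          = f.eval (powPoints γ e n v) - g.eval (powPoints γ e n v) := fun v => by
        rw [← eval_sub, eval_eq_sum_range' hd, Finset.sum_range]
      simp only [h1]
      rw [Finset.sum_sub_distrib, hT]
      simp only
      rw [Finset.sum_image hI.injOn]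
      rw [h𝒮.image_eq _ (S t).2, Finset.sum_image hJ.injOn, ← Finset.sum_sub_distrib]
      exact Finset.sum_eq_zero fun j _ => by rw [hIJ, sub_self]
    rw [← sub_eq_zero]
    ext m
    rw [coeff_zero]
    by_cases hm : m < k
    · exact congrFun hu ⟨m, hm⟩
    · exact coeff_eq_zero_of_natDegree_lt (by omega)

end Matching

/-! ### The points are distinct and nonzero. -/

section Points

variable {k e n p : ℕ} [Fact p.Prime] {F : Type*} [Field F] [Algebra (ZMod p) F] {γ : F}

theorem IsPowConstruction.powPoints_ne_zero (h : IsPowConstruction k e n p F γ)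
    (he : 1 < k ^ 2 * e) (i : Fin n) : powPoints γ e n i ≠ 0 := by
  refine pow_ne_zero _ ?_
  have := h.aeval_ne_zero (X_sub_C_ne_zero (((i : ℕ) + 1 : ℕ) : ZMod p))
    (by rwa [natDegree_X_sub_C])
  simpa using this

theorem IsPowConstruction.powPoints_injective (h : IsPowConstruction k e n p F γ)
    (hk : 1 ≤ k) (he : 0 < e) : Function.Injective (powPoints γ e n) := by
  intro i j hij
  by_contra hne
  set a : Fin n → ZMod p := fun i => (((i : ℕ) + 1 : ℕ) : ZMod p) with ha
  have haij : a i - a j ≠ 0 := sub_ne_zero.mpr fun h' => hne (injective_natCast_succ h.le_prime h')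
  set P : Fin n → (ZMod p)[X] := fun i => (X - C (a i)) ^ e with hP
  have hmonic : ∀ i, (P i).Monic := fun i => (monic_X_sub_C _).pow _
  have hdeg : ∀ i, (P i).natDegree = e := fun i => by simp [hP, natDegree_pow]
  have hne0 : P i - P j ≠ 0 := fun h0 => by
    have := congrArg (eval (a i)) h0
    simp only [hP, eval_sub, eval_pow, eval_X, eval_C, sub_self, zero_pow he.ne', zero_sub,
      eval_zero, neg_eq_zero] at this
    exact pow_ne_zero e haij this
  -- The cancellation of leading terms matters when `k = 1`, where the minimal polynomial has degree
  -- exactly `e`.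
  have hlt : (P i - P j).natDegree < e := by
    rw [← hdeg i]
    refine natDegree_lt_natDegree hne0 (degree_sub_lt_left ?_ (hmonic i).ne_zero ?_)
    · rw [degree_eq_natDegree (hmonic i).ne_zero, degree_eq_natDegree (hmonic j).ne_zero, hdeg,
        hdeg]
    · rw [(hmonic i).leadingCoeff, (hmonic j).leadingCoeff]
  refine h.aeval_ne_zero hne0 (hlt.trans_le (Nat.le_mul_of_pos_left _ (pow_pos hk 2))) ?_
  have h1 : ∀ i, aeval γ (P i) = powPoints γ e n i := fun i => by simp [hP, ha, powPoints]
  rw [map_sub, h1, h1, hij, sub_self]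

end Points

/-! ### From insdel errors to matched pairs. -/

section Robust

/-- `Z` consists of surviving symbols. Multisets suffice because the adversary permutes freely. -/
theorem InsdelErrors.exists_common {A : Type*} {m : ℕ} {s w : List A} (h : InsdelErrors m s w) :
    ∃ Z : Multiset A, Z ≤ s ∧ Z ≤ w ∧ s.length + w.length ≤ m + 2 * Z.card := by
  classical
  induction m generalizing s with
  | zero =>
    obtain rfl : s = w := h
    exact ⟨s, le_rfl, le_rfl, by simp; omega⟩
  | succ m ih =>
    obtain ⟨u, hstep, hu⟩ := h
    obtain ⟨Z, hZu, hZw, hZ⟩ := ih hu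
    cases hstep with
    | deletion l r a =>
      refine ⟨Z, hZu.trans ?_, hZw, ?_⟩
      · rw [← Multiset.coe_add, ← Multiset.coe_add, ← Multiset.cons_coe]
        exact add_le_add le_rfl (Multiset.le_cons_self _ _)
      · simp only [List.length_append, List.length_cons] at hZ ⊢
        omega
    | insertion l r a =>
      refine ⟨Z.erase a, ?_, (Multiset.erase_le a Z).trans hZw, ?_⟩
      · rw [Multiset.erase_le_iff_le_cons, ← Multiset.coe_add, ← Multiset.add_cons,
          Multiset.cons_coe, Multiset.coe_add]
        exact hZu
      · have h1 : Z.card ≤ (Z.erase a).card + 1 := by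
          rw [← Multiset.card_cons a]
          exact Multiset.card_le_card (Multiset.le_cons_erase Z a)
        simp only [List.length_append, List.length_cons] at hZ ⊢
        omega

theorem exists_injective_of_le_map {A ι : Type*} [DecidableEq ι] (c : ι → A) (L : List A)
    (s : Finset ι) (h : (L : Multiset A) ≤ s.val.map c) :
    ∃ I : Fin L.length → ι, Function.Injective I ∧ (∀ j, I j ∈ s) ∧ ∀ j, c (I j) = L.get j := by
  induction L generalizing s with
  | nil => exact ⟨fun j => j.elim0, fun j => j.elim0, fun j => j.elim0, fun j => j.elim0⟩
  | cons x L ih =>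
    rw [← Multiset.cons_coe] at h
    have hx : x ∈ s.val.map c := Multiset.mem_of_le h (Multiset.mem_cons_self _ _)
    obtain ⟨i, hi, rfl⟩ := Multiset.mem_map.mp hx
    have hs : s.val = i ::ₘ (s.erase i).val := by
      rw [Finset.erase_val, Multiset.cons_erase hi]
    rw [hs, Multiset.map_cons, Multiset.cons_le_cons_iff] at h
    obtain ⟨I, hI, hIs, hIc⟩ := ih _ h
    refine ⟨Fin.cons i I, ?_, ?_, ?_⟩
    · refine Fin.cons_injective_iff.mpr ⟨?_, hI⟩
      rintro ⟨j, hj⟩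
      exact Finset.ne_of_mem_erase (hIs j) hj
    · intro j
      refine Fin.cases hi (fun j => ?_) j
      exact Finset.mem_of_mem_erase (hIs j)
    · intro j
      refine Fin.cases rfl (fun j => ?_) j
      exact hIc j

/-- A common output of the adversary on two words yields a large matching between them. -/
theorem exists_matching_of_adversaryOutputs {A : Type*} {n t r : ℕ} (hr : r + t ≤ n)
    {c c' : Fin n → A} {w : List A} (h : w ∈ adversaryOutputs t c)
    (h' : w ∈ adversaryOutputs t c') : ∃ I J : Fin r → Fin n, Function.Injective I ∧
      Function.Injective J ∧ ∀ j, c (I j) = c' (J j) := by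
  classical
  obtain ⟨π, m, hm, hw⟩ := h
  obtain ⟨π', m', hm', hw'⟩ := h'
  obtain ⟨Z, hZs, hZw, hZ⟩ := hw.exists_common
  obtain ⟨Z', hZs', hZw', hZ'⟩ := hw'.exists_common
  rw [List.length_ofFn] at hZ hZ'
  -- Both survivor multisets lie in `w`, so inclusion–exclusion leaves at least `n - t` common
  -- symbols.
  have h1 : (Z ∪ Z').card ≤ w.length := by
    rw [← Multiset.coe_card]
    exact Multiset.card_le_card (Multiset.union_le hZw hZw')
  have h2 := congrArg Multiset.card (Multiset.union_add_inter Z Z')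
  rw [Multiset.card_add, Multiset.card_add] at h2
  set L := (Z ∩ Z').toList with hL
  have hLr : r ≤ L.length := by rw [hL, Multiset.length_toList]; omega
  obtain ⟨I, hI, -, hIc⟩ := exists_injective_of_le_map (fun i => c (π i)) L Finset.univ
    (by rw [hL, Multiset.coe_toList, Fin.univ_val_map]; exact Multiset.inter_le_left.trans hZs)
  obtain ⟨J, hJ, -, hJc⟩ := exists_injective_of_le_map (fun i => c' (π' i)) L Finset.univ
    (by rw [hL, Multiset.coe_toList, Fin.univ_val_map]; exact Multiset.inter_le_right.trans hZs')
  refine ⟨fun j => π (I (Fin.castLE hLr j)), fun j => π' (J (Fin.castLE hLr j)), ?_, ?_, ?_⟩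
  · exact π.injective.comp (hI.comp (Fin.castLE_injective hLr))
  · exact π'.injective.comp (hJ.comp (Fin.castLE_injective hLr))
  · intro j
    exact (hIc _).trans (hJc _).symm

variable {k e n p : ℕ} [Fact p.Prime] {F : Type*} [Field F] [Algebra (ZMod p) F] {γ : F}

theorem IsPowConstruction.robust (h : IsPowConstruction k e n p F γ) (hk : 1 ≤ k)
    (hkn : 2 * k - 1 ≤ n) (he : ((2 * k - 1)!) ^ 2 ≤ e) :
    RobustPermInsdel (n + 1 - 2 * k) (rsCode k (powPoints γ e n)) := by
  rintro c ⟨f, hf, rfl⟩ c' ⟨g, hg, rfl⟩ hne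
  rw [Set.disjoint_left]
  intro w hw hw'
  obtain ⟨I, J, hI, hJ, hIJ⟩ := exists_matching_of_adversaryOutputs (r := 2 * k - 1)
    (by omega) hw hw'
  exact hne (by rw [h.eq_of_match hk he hf hg hI hJ hIJ])

end Robust

/-! ### The ramp scheme. -/

section Shamir

variable {F : Type*} [Field F]

/-- Interpolate `v j / β j` and multiply by `X`; this is where nonzero points are needed. -/
theorem exists_sum_eq_of_injective {m l : ℕ} (hm : m ≤ l) (β : Fin m → F)
    (hβ : Function.Injective β) (hβ0 : ∀ j, β j ≠ 0) (v : Fin m → F) :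
    ∃ a : Fin l → F, ∀ j, ∑ i, a i * β j ^ ((i : ℕ) + 1) = v j := by
  set g := Lagrange.interpolate Finset.univ β fun j => v j / β j with hg
  have hdeg : g.degree < l := by
    refine (Lagrange.degree_interpolate_lt _ hβ.injOn).trans_le ?_
    simpa using hm
  refine ⟨fun i => g.coeff i, fun j => ?_⟩
  have h1 : g.eval (β j) = v j / β j :=
    Lagrange.eval_interpolate_at_node _ hβ.injOn (Finset.mem_univ j)
  have h2 : g.eval (β j) = ∑ i : Fin l, g.coeff i * β j ^ (i : ℕ) := by
    rcases eq_or_ne g 0 with h0 | h0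
    · simp [h0]
    · rw [eval_eq_sum_range' ((natDegree_lt_iff_degree_lt h0).mpr hdeg), Finset.sum_range]
  calc ∑ i : Fin l, g.coeff i * β j ^ ((i : ℕ) + 1) = g.eval (β j) * β j := by
        rw [h2, Finset.sum_mul]
        exact Finset.sum_congr rfl fun i _ => by ring
    _ = v j := by rw [h1, div_mul_cancel₀ _ (hβ0 j)]

theorem card_fiber_mul_card {G H : Type*} [AddGroup G] [Fintype G] [AddGroup H] [Fintype H]
    [DecidableEq H] (f : G →+ H) (hf : Function.Surjective f) (x : H) :
    (Finset.univ.filter fun g => f g = x).card * Fintype.card H = Fintype.card G := by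
  have h1 := Finset.card_eq_sum_card_fiberwise (f := f) (s := Finset.univ) (t := Finset.univ)
    fun _ _ => Finset.mem_coe.mpr (Finset.mem_univ _)
  rw [Finset.sum_congr rfl fun y _ => AddMonoidHom.card_fiber_eq_of_mem_range f (hf y) (hf x),
    Finset.sum_const, smul_eq_mul, Finset.card_univ, Finset.card_univ] at h1
  rw [h1, mul_comm]

theorem uniformOfFintype_toOuterMeasure_fiber {G H : Type*} [AddGroup G] [Fintype G] [AddGroup H]
    [Fintype H] (f : G →+ H) (hf : Function.Surjective f) (x : H) :
    (PMF.uniformOfFintype G).toOuterMeasure {g | f g = x} = (Fintype.card H : ℝ≥0∞)⁻¹ := by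
  classical
  rw [PMF.toOuterMeasure_uniformOfFintype_apply, ← card_fiber_mul_card f hf x]
  have h1 : Fintype.card {g | f g = x} = (Finset.univ.filter fun g => f g = x).card :=
    Fintype.card_of_subtype _ fun g => by simp
  obtain ⟨g, hg⟩ := hf x
  have h2 : (Finset.univ.filter fun g => f g = x).card ≠ 0 :=
    Finset.card_ne_zero.mpr ⟨g, by simpa using hg⟩
  rw [h1, Nat.cast_mul, ENNReal.div_eq_inv_mul,
    ENNReal.mul_inv (Or.inl (Nat.cast_ne_zero.mpr h2)) (Or.inl (ENNReal.natCast_ne_top _)),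
    mul_right_comm, ENNReal.inv_mul_cancel (Nat.cast_ne_zero.mpr h2) (ENNReal.natCast_ne_top _),
    one_mul]

/-- Up to the shift by `s`, the shares are a surjective additive image of the uniform coefficients,
so all fibres have equal size. -/
theorem shamirShare_toOuterMeasure [Fintype F] {n k m : ℕ} (α : Fin n → F)
    (hα : Function.Injective α) (hα0 : ∀ i, α i ≠ 0) (s : F) (hm : m ≤ k - 1)
    (I : Fin m → Fin n) (hI : Function.Injective I) (v : Fin m → F) :
    (shamirShare k α s).toOuterMeasure {sh | (fun j => sh (I j)) = v}
      = ((Fintype.card F : ℝ≥0∞)⁻¹) ^ m := by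
  let Λ : (Fin (k - 1) → F) →+ (Fin m → F) :=
    { toFun := fun a j => ∑ i, a i * α (I j) ^ ((i : ℕ) + 1)
      map_zero' := by ext; simp
      map_add' := fun a b => by ext; simp [add_mul, Finset.sum_add_distrib] }
  have hΛ : Function.Surjective Λ := fun w => by
    obtain ⟨a, ha⟩ := exists_sum_eq_of_injective hm (fun j => α (I j)) (hα.comp hI)
      (fun j => hα0 _) w
    exact ⟨a, funext ha⟩
  have hpre : (fun (a : Fin (k - 1) → F) (i : Fin n) =>
      (C s + ∑ j : Fin (k - 1), C (a j) * X ^ ((j : ℕ) + 1)).eval (α i)) ⁻¹'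
        {sh | (fun j => sh (I j)) = v} = {a | Λ a = fun j => v j - s} := by
    ext a
    simp only [Set.mem_preimage, Set.mem_ofPred_eq, funext_iff]
    refine forall_congr' fun j => ?_
    simp only [eval_add, eval_C, eval_finsetSum, eval_mul, eval_pow, eval_X]
    rw [eq_sub_iff_add_eq, add_comm]
    rfl
  rw [shamirShare, PMF.toOuterMeasure_map_apply, hpre,
    uniformOfFintype_toOuterMeasure_fiber Λ hΛ, Fintype.card_fun, Fintype.card_fin, Nat.cast_pow,
    ENNReal.inv_pow]

variable {k e n p : ℕ} [Fact p.Prime] [Algebra (ZMod p) F] {γ : F}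

theorem IsPowConstruction.isFullyAnonymousRamp [Fintype F] (h : IsPowConstruction k e n p F γ)
    (hk : 1 ≤ k) (hkn : 2 * k - 1 ≤ n) (he : ((2 * k - 1)!) ^ 2 ≤ e) (he1 : 1 < k ^ 2 * e) :
    IsFullyAnonymousRamp (k - 1) (2 * k - 1) n (shamirShare k (powPoints γ e n)) where
  gap := by omega
  threshold_le := hkn
  share_anonymity s m hm I hI v := shamirShare_toOuterMeasure _
    (h.powPoints_injective hk ((pow_pos (Nat.factorial_pos _) 2).trans_le he))
    (h.powPoints_ne_zero he1) s hm I hI v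
  anonymous_recon := by
    classical
    have huniq : ∀ (s s' : F) (I I' : Fin (2 * k - 1) → Fin n), Function.Injective I →
        Function.Injective I' → ∀ sh ∈ (shamirShare k (powPoints γ e n) s).support,
        ∀ sh' ∈ (shamirShare k (powPoints γ e n) s').support,
        (fun j => sh (I j)) = (fun j => sh' (I' j)) → s = s' := by
      intro s s' I I' hI hI' sh hsh sh' hsh' heq
      obtain ⟨a, -, rfl⟩ := (PMF.mem_support_map_iff _ _ _).mp hsh
      obtain ⟨a', -, rfl⟩ := (PMF.mem_support_map_iff _ _ _).mp hsh'
      have hdeg : ∀ (s : F) (a : Fin (k - 1) → F),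
          (C s + ∑ j : Fin (k - 1), C (a j) * X ^ ((j : ℕ) + 1)).degree < k := fun s a => by
        refine degree_le_natDegree.trans_lt (Nat.cast_lt.mpr (lt_of_le_of_lt
          (natDegree_add_le_of_degree_le ((natDegree_C s).le.trans (Nat.zero_le _))
            (natDegree_sum_C_mul_X_pow_succ_le a)) (by omega)))
      have := congrArg (fun f : F[X] => f.coeff 0)
        (h.eq_of_match hk he (hdeg s a) (hdeg s' a') hI hI' (congrFun heq))
      simpa only [coeff_add, coeff_C_zero, coeff_zero_sum_C_mul_X_pow_succ, add_zero] using this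
    -- The default `0` occurs only on tuples that no sharing produces.
    refine ⟨fun y => if hy : ∃ s : F, ∃ I : Fin (2 * k - 1) → Fin n, Function.Injective I ∧
      ∃ sh ∈ (shamirShare k (powPoints γ e n) s).support, (fun j => sh (I j)) = y
      then hy.choose else 0, fun s I hI sh hsh => ?_⟩
    have hy : ∃ s : F, ∃ I' : Fin (2 * k - 1) → Fin n, Function.Injective I' ∧
      ∃ sh' ∈ (shamirShare k (powPoints γ e n) s).support,
        (fun j => sh' (I' j)) = fun j => sh (I j) := ⟨s, I, hI, sh, hsh, rfl⟩
    simp only [dif_pos hy]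
    obtain ⟨I', hI', sh', hsh', heq⟩ := hy.choose_spec
    exact huniq _ _ _ _ hI' hI sh' hsh' sh hsh heq

end Shamir

/-! ### Existence of instances and field size. -/

section Existence

theorem exists_isPowConstruction (k e n N : ℕ) (hpos : 0 < k ^ 2 * e)
    (hN : 2 * max n (k ^ 2 * e) ≤ N) :
    ∃ (p : ℕ) (_ : Fact p.Prime) (F : Type) (_ : Field F) (_ : Fintype F)
      (_ : Algebra (ZMod p) F) (γ : F), IsPowConstruction k e n p F γ ∧
        Fintype.card F ≤ N ^ (k ^ 2 * e) := by
  -- Bertrand's postulate.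
  obtain ⟨p, hp, hlt, hle⟩ := Nat.exists_prime_lt_and_le_two_mul (max n (k ^ 2 * e)) (by omega)
  have : Fact p.Prime := ⟨hp⟩
  obtain ⟨γ, hγ⟩ := Field.exists_primitive_element (ZMod p) (GaloisField p (k ^ 2 * e))
  have hrank := GaloisField.finrank p hpos.ne'
  have hF : Fintype (GaloisField p (k ^ 2 * e)) := Fintype.ofFinite _
  refine ⟨p, this, GaloisField p (k ^ 2 * e), inferInstance, hF, inferInstance, γ,
    ⟨(le_max_right _ _).trans_lt hlt, (le_max_left _ _).trans hlt.le, hrank, hγ⟩, ?_⟩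
  rw [Module.card_eq_pow_finrank (K := ZMod p), hrank, ZMod.card]
  exact Nat.pow_le_pow_left (hle.trans hN) _

theorem ell_eq {k : ℕ} (hk : 1 ≤ k) : ell k = 2 * k ^ 2 * (2 * ((2 * k - 1)!) ^ 2) := by
  obtain ⟨m, hm⟩ : ∃ m, 2 * k = m + 1 := ⟨2 * k - 1, by omega⟩
  rw [ell, hm, Nat.factorial_succ, Nat.add_sub_cancel, mul_pow, ← hm]
  ring

/-- The bound on the prime has exponent of order `k²`, which the factor `2 * k ^ 2` in `ell_eq`
absorbs. -/
theorem two_mul_max_le_pow {k n : ℕ} (hk : 1 ≤ k) (hn : 2 ≤ n) (hkn : 2 * k - 1 ≤ n) :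
    2 * max n (k ^ 2 * (2 * ((2 * k - 1)!) ^ 2)) ≤ n ^ (4 * (2 * k ^ 2)) := by
  have h1 : (2 * k - 1)! ≤ n ^ (2 * k - 1) :=
    (Nat.factorial_le_pow _).trans (Nat.pow_le_pow_left hkn _)
  have hkn' : k ≤ n := by omega
  have h2 : k ^ 2 * (2 * ((2 * k - 1)!) ^ 2) ≤ n ^ 2 * (n * (n ^ (2 * k - 1)) ^ 2) :=
    Nat.mul_le_mul (Nat.pow_le_pow_left hkn' 2) (Nat.mul_le_mul hn (Nat.pow_le_pow_left h1 2))
  have h3 : n ^ 2 * (n * (n ^ (2 * k - 1)) ^ 2) = n ^ (3 + 2 * (2 * k - 1)) := by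
    rw [← pow_mul]; ring
  have h4 : n ≤ n ^ (3 + 2 * (2 * k - 1)) := Nat.le_self_pow (by omega) n
  calc 2 * max n (k ^ 2 * (2 * ((2 * k - 1)!) ^ 2)) ≤ n * n ^ (3 + 2 * (2 * k - 1)) :=
        Nat.mul_le_mul hn (max_le h4 (h3 ▸ h2))
    _ = n ^ (4 + 2 * (2 * k - 1)) := by ring
    _ ≤ n ^ (4 * (2 * k ^ 2)) := Nat.pow_le_pow_right (by omega) (by
        have : k ≤ k ^ 2 := Nat.le_self_pow (by norm_num) k
        omega)

end Existence

/-- Part 1: every instance of the construction with exponent `ℓ = ((2k)!)²` yields distinct nonzero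
points, a robust Reed–Solomon code and a fully anonymous ramp scheme. Part 2: an instance exists
over a field of size at most `n ^ (c * A * k² ℓ)` as soon as `k² ℓ ≤ n ^ A`, with `c` absolute.
Part 3: for all `k, n` a field of size at most `n ^ (c * k² ℓ)`, with `c` absolute, is reached by
the same kind of points `(γ - i) ^ e` with some exponent `e ≤ ℓ`. -/
theorem mainTheorem3 :
    (∀ (k n p : ℕ) [Fact p.Prime] (F : Type*) [Field F] [Fintype F] [Algebra (ZMod p) F] (γ : F),
      1 ≤ k → 2 * k - 1 ≤ n → IsPowConstruction k (ell k) n p F γ →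
        Fintype.card F = p ^ (k ^ 2 * ell k) ∧
        Function.Injective (powPoints γ (ell k) n) ∧
        (∀ i, powPoints γ (ell k) n i ≠ 0) ∧
        RobustPermInsdel (n + 1 - 2 * k) (rsCode k (powPoints γ (ell k) n)) ∧
        IsFullyAnonymousRamp (k - 1) (2 * k - 1) n (shamirShare k (powPoints γ (ell k) n))) ∧
    (∃ c : ℕ, ∀ A k n : ℕ, 1 ≤ k → 2 ≤ n → 2 * k - 1 ≤ n → k ^ 2 * ell k ≤ n ^ A →
      ∃ (p : ℕ) (_ : Fact p.Prime) (F : Type) (_ : Field F) (_ : Fintype F)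
        (_ : Algebra (ZMod p) F) (γ : F),
        IsPowConstruction k (ell k) n p F γ ∧
        Fintype.card F ≤ n ^ (c * A * (k ^ 2 * ell k))) ∧
    (∃ c : ℕ, ∀ k n : ℕ, 1 ≤ k → 2 ≤ n → 2 * k - 1 ≤ n →
      ∃ (e p : ℕ) (_ : Fact p.Prime) (F : Type) (_ : Field F) (_ : Fintype F)
        (_ : Algebra (ZMod p) F) (γ : F),
        e ≤ ell k ∧ IsPowConstruction k e n p F γ ∧
        Fintype.card F ≤ n ^ (c * (k ^ 2 * ell k)) ∧
        Function.Injective (powPoints γ e n) ∧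
        (∀ i, powPoints γ e n i ≠ 0) ∧
        RobustPermInsdel (n + 1 - 2 * k) (rsCode k (powPoints γ e n)) ∧
        IsFullyAnonymousRamp (k - 1) (2 * k - 1) n (shamirShare k (powPoints γ e n))) := by
  have hfac : ∀ k : ℕ, 1 ≤ ((2 * k - 1)!) ^ 2 := fun k => pow_pos (Nat.factorial_pos _) 2
  have hle : ∀ k, 1 ≤ k → 2 * ((2 * k - 1)!) ^ 2 ≤ ell k := fun k hk => by
    rw [ell_eq hk]
    exact Nat.le_mul_of_pos_left _ (by positivity)
  have hsq : ∀ k e : ℕ, 1 ≤ k → e ≤ k ^ 2 * e := fun k e hk =>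
    Nat.le_mul_of_pos_left _ (pow_pos hk 2)
  refine ⟨?_, ⟨2, ?_⟩, ⟨4, ?_⟩⟩
  · intro k n p _ F _ _ _ γ hk hkn h
    have h1 := hfac k
    have h2 := hle k hk
    have h3 := hsq k (ell k) hk
    refine ⟨?_, h.powPoints_injective hk (by omega), h.powPoints_ne_zero (by omega),
      h.robust hk hkn (by omega), h.isFullyAnonymousRamp hk hkn (by omega) (by omega)⟩
    rw [Module.card_eq_pow_finrank (K := ZMod p), h.finrank_eq, ZMod.card]
  · intro A k n hk hn hkn hA
    have h1 := hfac k
    have h2 := hle k hk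
    have h3 := hsq k (ell k) hk
    have hA0 : A ≠ 0 := by rintro rfl; rw [pow_zero] at hA; omega
    obtain ⟨p, hp, F, i1, i2, i3, γ, h, hc⟩ := exists_isPowConstruction k (ell k) n (n ^ (2 * A))
      (by omega) (by
        calc 2 * max n (k ^ 2 * ell k) ≤ n * n ^ A :=
              Nat.mul_le_mul hn (max_le (Nat.le_self_pow hA0 n) hA)
          _ = n ^ (A + 1) := by ring
          _ ≤ n ^ (2 * A) := Nat.pow_le_pow_right (by omega) (by omega))
    exact ⟨p, hp, F, i1, i2, i3, γ, h, by rwa [← pow_mul] at hc⟩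
  · intro k n hk hn hkn
    have h1 := hfac k
    have h2 := hle k hk
    -- The square alone would suffice for matching; the factor `2` ensures `1 < k ^ 2 * e`, hence
    -- nonzero points, also for `k = 1`.
    set e := 2 * ((2 * k - 1)!) ^ 2 with he
    have h3 := hsq k e hk
    obtain ⟨p, hp, F, i1, i2, i3, γ, h, hc⟩ := exists_isPowConstruction k e n _
      (by omega) (two_mul_max_le_pow hk hn hkn)
    refine ⟨e, p, hp, F, i1, i2, i3, γ, h2, h, ?_, h.powPoints_injective hk (by omega),
      h.powPoints_ne_zero (by omega), h.robust hk hkn (by omega),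
      h.isFullyAnonymousRamp hk hkn (by omega) (by omega)⟩
    rw [← pow_mul] at hc
    refine hc.trans_eq ?_
    rw [ell_eq hk, ← he]
    congr 1
    ring
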